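/- Theorem. Let $k$ be an algebraically closed field of characteristic zero and let $X$ be a variety over $k$ (an integral separated scheme of finite type over $k$) of dimension $n$ which is locally a complete intersection, i.e. every point of $X$ has an open neighbourhood isomorphic over $k$ to $\operatorname{Spec} k[x_1,\dots,x_N]/(g_1,\dots,g_c)$ for some $N$, $c$ and $g_1,\dots,g_c$ such that this ring has Krull dimension $N-c$. For $m\ge 0$ let $\mathcal W_m(X)$ be the $m$-th wedge scheme of $X$, i.e. the $k$-scheme that represents the functor $$Z\longmapsto \operatorname{Hom}_k\bigl(Z\times_k\operatorname{Spec} k[s,t]/(s,t)^{m+1},\,X\bigr)$$ on $k$-schemes, and let $\pi_m:\mathcal W_m(X)\to X$ be the natural projection, induced by $\operatorname{Spec} k\hookrightarrow\operatorname{Spec} k[s,t]/(s,t)^{m+1}$. Let $X^{sing}\subseteq X$ be the singular locus, i.e. the set of points at which $X$ is not smooth over $k$. Then: 1. $\mathcal W_m(X)$ is pure dimensional (all its irreducible components have the same dimension) if and only if $\dim\mathcal W_m(X)=\frac12 n(m+1)(m+2)$, and in this case $\mathcal W_m(X)$ is locally a complete intersection. 2. $\mathcal W_m(X)$ is irreducible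 if and only if $\dim\pi_m^{-1}(X^{sing})<\frac12 n(m+1)(m+2)$ (where the empty set has dimension $-\infty$). -/

import Mathlib

open CategoryTheory AlgebraicGeometry

universe u

namespace WedgeScheme

/-! ### Truncated polynomials `R[s,t]/(s,t)^(m+1)` -/

/-- The ring `R[s,t]/(s,t)^(m+1)`. -/
abbrev Trunc (m : ℕ) (R : Type*) [CommRing R] : Type _ :=
  MvPolynomial (Fin 2) R ⧸ (MvPolynomial.idealOfVars (Fin 2) R) ^ (m + 1)

namespace Trunc

variable {m : ℕ} {R : Type*} [CommRing R]

/-- The class of a polynomial in `s`, `t`. -/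
noncomputable abbrev mk (m : ℕ) {R : Type*} [CommRing R] : MvPolynomial (Fin 2) R →+* Trunc m R :=
  Ideal.Quotient.mk _

/-- The coefficient of `s^(e 0) t^(e 1)` in an element of `R[s,t]/(s,t)^(m+1)`, for `|e| ≤ m`;
zero for `|e| > m`. -/
noncomputable def coeff (e : Fin 2 →₀ ℕ) (x : Trunc m R) : R :=
  if e.degree ≤ m then (Quotient.out x : MvPolynomial (Fin 2) R).coeff e else 0

theorem coeff_mk (e : Fin 2 →₀ ℕ) (he : e.degree ≤ m) (p : MvPolynomial (Fin 2) R) :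
    coeff e (mk m p) = p.coeff e := by
  have h : (Quotient.out (mk m p) : MvPolynomial (Fin 2) R) - p ∈
      (MvPolynomial.idealOfVars (Fin 2) R) ^ (m + 1) := by
    rw [← Ideal.Quotient.eq]
    exact Quotient.out_eq _
  have h2 := (MvPolynomial.mem_pow_idealOfVars_iff' _ _).mp h e (by omega)
  rw [coeff, if_pos he]
  rw [MvPolynomial.coeff_sub, sub_eq_zero] at h2
  exact h2

theorem coeff_of_lt (e : Fin 2 →₀ ℕ) (he : m < e.degree) (x : Trunc m R) : coeff e x = 0 :=
  if_neg (by omega)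

theorem ext_coeff {x y : Trunc m R}
    (h : ∀ e : Fin 2 →₀ ℕ, e.degree ≤ m → coeff e x = coeff e y) : x = y := by
  obtain ⟨p, rfl⟩ := Ideal.Quotient.mk_surjective x
  obtain ⟨q, rfl⟩ := Ideal.Quotient.mk_surjective y
  rw [Ideal.Quotient.eq, MvPolynomial.mem_pow_idealOfVars_iff']
  intro e he
  have := h e (by omega)
  rw [coeff_mk e (by omega), coeff_mk e (by omega)] at this
  rw [MvPolynomial.coeff_sub, this, sub_self]

theorem coeff_add (e : Fin 2 →₀ ℕ) (x y : Trunc m R) :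
    coeff e (x + y) = coeff e x + coeff e y := by
  by_cases he : e.degree ≤ m
  · obtain ⟨p, rfl⟩ := Ideal.Quotient.mk_surjective x
    obtain ⟨q, rfl⟩ := Ideal.Quotient.mk_surjective y
    rw [← map_add, coeff_mk e he, coeff_mk e he, coeff_mk e he, MvPolynomial.coeff_add]
  · simp [coeff, he]

theorem coeff_mul (e : Fin 2 →₀ ℕ) (he : e.degree ≤ m) (x y : Trunc m R) :
    coeff e (x * y) = ∑ p ∈ Finset.HasAntidiagonal.antidiagonal e, coeff p.1 x * coeff p.2 y := by
  obtain ⟨p, rfl⟩ := Ideal.Quotient.mk_surjective x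
  obtain ⟨q, rfl⟩ := Ideal.Quotient.mk_surjective y
  rw [← map_mul, coeff_mk e he, MvPolynomial.coeff_mul]
  refine Finset.sum_congr rfl fun z hz ↦ ?_
  have h : z.1.degree + z.2.degree = e.degree := by
    rw [← Finset.HasAntidiagonal.mem_antidiagonal.mp hz, map_add]
  rw [coeff_mk _ (by omega), coeff_mk _ (by omega)]

theorem coeff_algebraMap {k : Type*} [CommRing k] [Algebra k R] (e : Fin 2 →₀ ℕ) (c : k) :
    coeff e (algebraMap k (Trunc m R) c) = if e = 0 then algebraMap k R c else 0 := by
  by_cases he : e.degree ≤ m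
  · have : algebraMap k (Trunc m R) c = mk m (MvPolynomial.C (algebraMap k R c)) := rfl
    rw [this, coeff_mk e he, MvPolynomial.coeff_C]
    simp only [eq_comm]
  · have : e ≠ 0 := by rintro rfl; simp at he
    simp [coeff, he, this]

/-- An element of `R[s,t]/(s,t)^(m+1)` with invertible constant term is invertible. -/
theorem isUnit_of_coeff_zero (x : Trunc m R) (hx : IsUnit (coeff 0 x)) : IsUnit x := by
  obtain ⟨p, rfl⟩ := Ideal.Quotient.mk_surjective x
  rw [coeff_mk 0 (by simp)] at hx
  have h1 : p - MvPolynomial.C (p.coeff 0) ∈ MvPolynomial.idealOfVars (Fin 2) R := by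
    rw [← pow_one (MvPolynomial.idealOfVars (Fin 2) R), MvPolynomial.mem_pow_idealOfVars_iff']
    intro e he
    have : e = 0 := by
      rw [← Finsupp.degree_eq_zero_iff]; omega
    subst this
    simp
  have h2 : IsNilpotent (mk m (p - MvPolynomial.C (p.coeff 0))) := by
    refine ⟨m + 1, ?_⟩
    rw [← map_pow, Ideal.Quotient.eq_zero_iff_mem]
    exact Ideal.pow_mem_pow h1 _
  have h3 : IsUnit (mk m (MvPolynomial.C (p.coeff 0))) := (hx.map MvPolynomial.C).map _
  have h4 := h2.isUnit_add_left_of_commute h3 (Commute.all _ _)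
  rwa [← map_add, add_sub_cancel] at h4

end Trunc

/-! ### The coordinate ring of the `m`-th wedge scheme of an affine scheme -/

/-- The relations between the indeterminates `X (a, e)`, which stand for the coefficient of
`s^(e 0) t^(e 1)` of the image of `a` under the universal `k`-algebra homomorphism from `A` to a
ring of the form `R[s,t]/(s,t)^(m+1)`. -/
inductive WedgeRel (k : Type*) (m : ℕ) (A : Type*) [CommRing k] [CommRing A] [Algebra k A] :
    MvPolynomial (A × (Fin 2 →₀ ℕ)) k → Prop
  | add (a b : A) (e : Fin 2 →₀ ℕ) :
      WedgeRel k m A (MvPolynomial.X (a + b, e) - (MvPolynomial.X (a, e) + MvPolynomial.X (b, e)))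
  | mul (a b : A) (e : Fin 2 →₀ ℕ) (he : e.degree ≤ m) :
      WedgeRel k m A (MvPolynomial.X (a * b, e) -
        ∑ p ∈ Finset.HasAntidiagonal.antidiagonal e, MvPolynomial.X (a, p.1) * MvPolynomial.X (b, p.2))
  | const (c : k) (e : Fin 2 →₀ ℕ) :
      WedgeRel k m A (MvPolynomial.X (algebraMap k A c, e) - MvPolynomial.C (if e = 0 then c else 0))
  | high (a : A) (e : Fin 2 →₀ ℕ) (he : m < e.degree) :
      WedgeRel k m A (MvPolynomial.X (a, e))

/-- The coordinate ring of the `m`-th wedge scheme of `Spec A`. It corepresents the functor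
`R ↦ Hom_k(A, R[s,t]/(s,t)^(m+1))`, see `wedgeAlgHomEquiv`. -/
def WedgeAlg (k : Type*) (m : ℕ) (A : Type*) [CommRing k] [CommRing A] [Algebra k A] :
    Type _ :=
  MvPolynomial (A × (Fin 2 →₀ ℕ)) k ⧸ Ideal.span {p | WedgeRel k m A p}

noncomputable instance (k : Type*) (m : ℕ) (A : Type*) [CommRing k] [CommRing A] [Algebra k A] :
    CommRing (WedgeAlg k m A) :=
  inferInstanceAs (CommRing (MvPolynomial (A × (Fin 2 →₀ ℕ)) k ⧸ Ideal.span {p | WedgeRel k m A p}))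

noncomputable instance (k : Type*) (m : ℕ) (A : Type*) [CommRing k] [CommRing A] [Algebra k A] :
    Algebra k (WedgeAlg k m A) :=
  inferInstanceAs
    (Algebra k (MvPolynomial (A × (Fin 2 →₀ ℕ)) k ⧸ Ideal.span {p | WedgeRel k m A p}))

namespace WedgeAlg

variable {k : Type*} {m : ℕ} {A B R : Type*} [CommRing k] [CommRing A] [Algebra k A]
  [CommRing B] [Algebra k B] [CommRing R] [Algebra k R]

/-- The quotient map that defines `WedgeAlg k m A`. -/
noncomputable def mk (k : Type*) (m : ℕ) (A : Type*) [CommRing k] [CommRing A] [Algebra k A] :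
    MvPolynomial (A × (Fin 2 →₀ ℕ)) k →ₐ[k] WedgeAlg k m A :=
  Ideal.Quotient.mkₐ k (Ideal.span {p | WedgeRel k m A p})

/-- The universal coefficient `a^(e)`. -/
noncomputable def d (k : Type*) (m : ℕ) {A : Type*} [CommRing k] [CommRing A] [Algebra k A]
    (e : Fin 2 →₀ ℕ) (a : A) : WedgeAlg k m A :=
  mk k m A (MvPolynomial.X (a, e))

theorem rel_eq_zero {p : MvPolynomial (A × (Fin 2 →₀ ℕ)) k} (h : WedgeRel k m A p) :
    mk k m A p = 0 :=
  Ideal.Quotient.eq_zero_iff_mem.mpr (Ideal.subset_span h)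

theorem d_add (e : Fin 2 →₀ ℕ) (a b : A) : d k m e (a + b) = d k m e a + d k m e b := by
  simpa [sub_eq_zero, d] using rel_eq_zero (WedgeRel.add (k := k) (m := m) a b e)

theorem d_mul (e : Fin 2 →₀ ℕ) (he : e.degree ≤ m) (a b : A) :
    d k m e (a * b) =
      ∑ p ∈ Finset.HasAntidiagonal.antidiagonal e, d k m p.1 a * d k m p.2 b := by
  simpa [sub_eq_zero, d] using rel_eq_zero (WedgeRel.mul (k := k) (m := m) a b e he)

theorem d_algebraMap (e : Fin 2 →₀ ℕ) (c : k) :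
    d k m e (algebraMap k A c) = if e = 0 then algebraMap k (WedgeAlg k m A) c else 0 := by
  have h := rel_eq_zero (WedgeRel.const (m := m) (A := A) c e)
  rw [map_sub, sub_eq_zero] at h
  rw [d, h, ← MvPolynomial.algebraMap_eq, AlgHom.commutes]
  split_ifs <;> simp

theorem d_of_lt (e : Fin 2 →₀ ℕ) (he : m < e.degree) (a : A) : d k m e a = 0 :=
  rel_eq_zero (WedgeRel.high (k := k) a e he)

theorem hom_ext {S : Type*} [CommRing S] [Algebra k S] {φ ψ : WedgeAlg k m A →ₐ[k] S}
    (h : ∀ (e : Fin 2 →₀ ℕ) (a : A), φ (d k m e a) = ψ (d k m e a)) : φ = ψ := by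
  have h' : φ.comp (mk k m A) = ψ.comp (mk k m A) := by
    apply MvPolynomial.algHom_ext
    rintro ⟨a, e⟩
    exact h e a
  ext x
  obtain ⟨p, rfl⟩ := Ideal.Quotient.mk_surjective x
  exact DFunLike.congr_fun h' p

/-- The homomorphism `WedgeAlg k m A → R` attached to `A → R[s,t]/(s,t)^(m+1)`. -/
noncomputable def lift (α : A →ₐ[k] Trunc m R) : WedgeAlg k m A →ₐ[k] R :=
  Ideal.Quotient.liftₐ (Ideal.span {p | WedgeRel k m A p})
    (MvPolynomial.aeval fun x : A × (Fin 2 →₀ ℕ) ↦ Trunc.coeff x.2 (α x.1)) <| by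
    intro p hp
    change p ∈ RingHom.ker _
    revert p
    change Ideal.span _ ≤ RingHom.ker _
    rw [Ideal.span_le]
    rintro _ (⟨a, b, e⟩ | ⟨a, b, e, he⟩ | ⟨c, e⟩ | ⟨a, e, he⟩)
    · simp [Trunc.coeff_add]
    · simp [Trunc.coeff_mul e he]
    · simp only [SetLike.mem_coe, RingHom.mem_ker, map_sub,
        MvPolynomial.aeval_X, AlgHom.commutes, Trunc.coeff_algebraMap]
      split_ifs <;> simp
    · simp [Trunc.coeff_of_lt e he]

@[simp]
theorem lift_d (α : A →ₐ[k] Trunc m R) (e : Fin 2 →₀ ℕ) (a : A) :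
    lift α (d k m e a) = Trunc.coeff e (α a) := by
  exact (Ideal.Quotient.lift_mk (Ideal.span {p | WedgeRel k m A p}) _ _).trans
    (MvPolynomial.aeval_X _ _)

/-- The truncated polynomial with given coefficients. -/
noncomputable def ofCoeff (m : ℕ) {R : Type*} [CommRing R] (g : (Fin 2 →₀ ℕ) → R) : Trunc m R :=
  Trunc.mk m (MvPowerSeries.truncTotal (m + 1) (id g : MvPowerSeries (Fin 2) R))

theorem coeff_ofCoeff (g : (Fin 2 →₀ ℕ) → R) (e : Fin 2 →₀ ℕ) (he : e.degree ≤ m) :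
    Trunc.coeff e (ofCoeff m g) = g e := by
  rw [ofCoeff, Trunc.coeff_mk e he]
  exact MvPowerSeries.coeff_truncTotal (R := R) (id g) (by omega)

/-- The homomorphism `A → R[s,t]/(s,t)^(m+1)` attached to `WedgeAlg k m A → R`. -/
noncomputable def unlift (β : WedgeAlg k m A →ₐ[k] R) : A →ₐ[k] Trunc m R where
  toFun a := ofCoeff m fun e ↦ β (d k m e a)
  map_one' := by
    refine Trunc.ext_coeff fun e he ↦ ?_
    have h1 := d_algebraMap (A := A) (m := m) e (1 : k)
    have h2 := Trunc.coeff_algebraMap (R := R) (m := m) e (1 : k)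
    rw [map_one] at h1 h2
    rw [coeff_ofCoeff _ e he, h1, h2]
    split_ifs <;> simp
  map_mul' a b := by
    refine Trunc.ext_coeff fun e he ↦ ?_
    rw [coeff_ofCoeff _ e he, Trunc.coeff_mul e he, d_mul e he, map_sum]
    refine Finset.sum_congr rfl fun z hz ↦ ?_
    have h : z.1.degree + z.2.degree = e.degree := by
      rw [← Finset.HasAntidiagonal.mem_antidiagonal.mp hz, map_add]
    rw [coeff_ofCoeff _ _ (by omega), coeff_ofCoeff _ _ (by omega), map_mul]
  map_zero' := by
    refine Trunc.ext_coeff fun e he ↦ ?_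
    have h1 := d_algebraMap (A := A) (m := m) e (0 : k)
    have h2 := Trunc.coeff_algebraMap (R := R) (m := m) e (0 : k)
    rw [map_zero] at h1 h2
    rw [coeff_ofCoeff _ e he, h1, h2]
    split_ifs <;> simp
  map_add' a b := by
    refine Trunc.ext_coeff fun e he ↦ ?_
    rw [coeff_ofCoeff _ e he, Trunc.coeff_add, d_add, map_add, coeff_ofCoeff _ e he,
      coeff_ofCoeff _ e he]
  commutes' c := by
    refine Trunc.ext_coeff fun e he ↦ ?_
    rw [coeff_ofCoeff _ e he, d_algebraMap, Trunc.coeff_algebraMap]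
    split_ifs <;> simp

theorem coeff_unlift (β : WedgeAlg k m A →ₐ[k] R) (e : Fin 2 →₀ ℕ) (he : e.degree ≤ m) (a : A) :
    Trunc.coeff e (unlift β a) = β (d k m e a) :=
  coeff_ofCoeff _ e he

/-- The universal property of `WedgeAlg k m A`. -/
noncomputable def wedgeAlgHomEquiv : (WedgeAlg k m A →ₐ[k] R) ≃ (A →ₐ[k] Trunc m R) where
  toFun := unlift
  invFun := lift
  left_inv β := by
    refine hom_ext fun e a ↦ ?_
    rw [lift_d]
    by_cases he : e.degree ≤ m
    · exact coeff_unlift β e he a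
    · rw [d_of_lt e (by omega), map_zero, Trunc.coeff_of_lt e (by omega)]
  right_inv α := by
    ext a
    refine Trunc.ext_coeff fun e he ↦ ?_
    rw [coeff_unlift _ e he, lift_d]

/-- `WedgeAlg k m` is functorial. -/
noncomputable def map (k : Type*) (m : ℕ) {A B : Type*} [CommRing k] [CommRing A] [Algebra k A]
    [CommRing B] [Algebra k B] (g : A →ₐ[k] B) : WedgeAlg k m A →ₐ[k] WedgeAlg k m B :=
  lift ((unlift (AlgHom.id k (WedgeAlg k m B))).comp g)

@[simp]
theorem map_d (g : A →ₐ[k] B) (e : Fin 2 →₀ ℕ) (a : A) :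
    map k m g (d k m e a) = d k m e (g a) := by
  rw [map, lift_d]
  by_cases he : e.degree ≤ m
  · rw [AlgHom.comp_apply, coeff_unlift _ e he, AlgHom.id_apply]
  · rw [d_of_lt e (by omega), Trunc.coeff_of_lt e (by omega)]

/-- The homomorphism `A → WedgeAlg k m A` that corresponds to the projection of the wedge scheme
of `Spec A` onto `Spec A`: it sends `a` to the universal constant term `a^(0)`. -/
noncomputable def base (k : Type*) (m : ℕ) (A : Type*) [CommRing k] [CommRing A] [Algebra k A] :
    A →ₐ[k] WedgeAlg k m A where
  toFun := d k m 0
  map_one' := by simpa using d_algebraMap (A := A) (m := m) 0 (1 : k)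
  map_mul' a b := by simpa using d_mul (k := k) (m := m) 0 (by simp) a b
  map_zero' := by simpa using d_algebraMap (A := A) (m := m) 0 (0 : k)
  map_add' a b := d_add 0 a b
  commutes' c := by simpa using d_algebraMap (A := A) (m := m) 0 c

theorem base_apply (a : A) : base k m A a = d k m 0 a := rfl

/-- The formation of wedge schemes commutes with localization. -/
theorem isLocalization_away (g : A →ₐ[k] B) (f : A)
    (h : letI := g.toRingHom.toAlgebra; IsLocalization.Away f B) :
    letI := (map k m g).toRingHom.toAlgebra
    IsLocalization.Away (base k m A f) (WedgeAlg k m B) := by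
  let := g.toRingHom.toAlgebra
  let := (map k m g).toRingHom.toAlgebra
  have hg : ∀ a, algebraMap A B a = g a := fun _ ↦ rfl
  have hm : ∀ a, algebraMap (WedgeAlg k m A) (WedgeAlg k m B) a = map k m g a := fun _ ↦ rfl
  have : IsScalarTower k A B := .of_algebraMap_eq' g.comp_algebraMap.symm
  have : IsScalarTower k (WedgeAlg k m A) (WedgeAlg k m B) :=
    .of_algebraMap_eq' (map k m g).comp_algebraMap.symm
  let L := Localization.Away (base k m A f)
  let ι : WedgeAlg k m A →ₐ[k] L := IsScalarTower.toAlgHom k (WedgeAlg k m A) L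
  have hfB : IsUnit (g f) := IsLocalization.Away.algebraMap_isUnit (S := B) f
  let α : A →ₐ[k] Trunc m L := unlift ι
  have hα : IsUnit (α f) := by
    apply Trunc.isUnit_of_coeff_zero
    rw [coeff_unlift _ 0 (by simp)]
    exact IsLocalization.Away.algebraMap_isUnit (S := L) (base k m A f)
  let αB : B →ₐ[k] Trunc m L := IsLocalization.liftAlgHom (M := Submonoid.powers f) (f := α) (by
    rintro ⟨_, n, rfl⟩
    simpa using hα.pow n)
  have hαB : ∀ a, αB (g a) = α a := fun a ↦ IsLocalization.lift_eq _ a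
  let φ : WedgeAlg k m B →ₐ[k] L := lift αB
  have hφ : ∀ x, φ (map k m g x) = algebraMap _ L x := by
    intro x
    have : φ.comp (map k m g) = ι := by
      refine hom_ext fun e a ↦ ?_
      rw [AlgHom.comp_apply, map_d, lift_d, hαB]
      by_cases he : e.degree ≤ m
      · exact coeff_unlift _ e he _
      · rw [d_of_lt e (by omega), map_zero, Trunc.coeff_of_lt e (by omega)]
    exact DFunLike.congr_fun this x
  have hu : IsUnit (algebraMap (WedgeAlg k m A) (WedgeAlg k m B) (base k m A f)) := by
    rw [hm, base_apply, map_d, ← base_apply]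
    exact hfB.map _
  let ψ : L →ₐ[WedgeAlg k m A] WedgeAlg k m B :=
    IsLocalization.liftAlgHom (M := Submonoid.powers (base k m A f))
      (f := Algebra.ofId (WedgeAlg k m A) (WedgeAlg k m B)) (by
    rintro ⟨_, n, rfl⟩
    simpa using hu.pow n)
  let φ' : WedgeAlg k m B →ₐ[WedgeAlg k m A] L := { φ with commutes' := hφ }
  have h1 : φ'.comp ψ = AlgHom.id _ _ :=
    IsLocalization.algHom_ext (Submonoid.powers (base k m A f)) (by ext)
  have h2 : ((ψ.restrictScalars k).comp φ) = AlgHom.id k _ := by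
    have key : (unlift ((ψ.restrictScalars k).comp φ)) = unlift (AlgHom.id k (WedgeAlg k m B)) := by
      refine AlgHom.coe_ringHom_injective (IsLocalization.ringHom_ext (Submonoid.powers f) ?_)
      ext a
      refine Trunc.ext_coeff fun e he ↦ ?_
      change Trunc.coeff e (unlift _ (g a)) = Trunc.coeff e (unlift _ (g a))
      rw [coeff_unlift _ e he, coeff_unlift _ e he, ← map_d]
      change ψ (φ _) = _
      rw [hφ]
      exact ψ.commutes _
    exact wedgeAlgHomEquiv.injective key
  let E : L ≃ₐ[WedgeAlg k m A] WedgeAlg k m B :=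
    AlgEquiv.ofAlgHom ψ φ' (AlgHom.ext fun x ↦ DFunLike.congr_fun h2 x) h1
  exact IsLocalization.isLocalization_of_algEquiv _ E

end WedgeAlg

/-! ### The `m`-th wedge scheme of a scheme over `k` -/

section Glue

variable {k : Type u} [Field k] {X : Scheme.{u}} (f : X ⟶ Spec (.of k)) (m : ℕ)

/-- The `k`-algebra structure on `Γ(X, U)` for a `k`-scheme `f : X ⟶ Spec k`. -/
noncomputable def sectionsMap (U : X.Opens) : k →+* Γ(X, U) :=
  ((Scheme.ΓSpecIso (.of k)).inv ≫ f.appLE ⊤ U le_top).hom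

/-- `Γ(X, U)` as an object of the category of commutative `k`-algebras. -/
noncomputable def sectionsAlg (U : X.Opens) : CommAlgCat.{u} k :=
  letI := (sectionsMap f U).toAlgebra
  CommAlgCat.of k Γ(X, U)

/-- Restriction of sections, as a homomorphism of `k`-algebras. -/
noncomputable def sectionsRes {U V : X.Opens} (h : U ≤ V) :
    sectionsAlg f V →ₐ[k] sectionsAlg f U where
  __ := (X.presheaf.map (homOfLE h).op).hom
  commutes' c := by
    change (X.presheaf.map (homOfLE h).op).hom (sectionsMap f V c) = sectionsMap f U c
    rw [sectionsMap, sectionsMap, ← Scheme.Hom.appLE_map f le_top (homOfLE h).op]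
    rfl

theorem sectionsRes_refl (U : X.Opens) (a : sectionsAlg f U) :
    sectionsRes f (le_refl U) a = a :=
  congr($(X.presheaf.map_id (.op U)).hom a)

theorem sectionsRes_trans {U V W : X.Opens} (h : U ≤ V) (h' : V ≤ W) (a : sectionsAlg f W) :
    sectionsRes f (h.trans h') a = sectionsRes f h (sectionsRes f h' a) :=
  congr($(X.presheaf.map_comp (homOfLE h').op (homOfLE h).op).hom a)

/-- The presheaf of rings `U ↦ WedgeAlg k m Γ(X, U)` on the affine open subsets of `X`. -/
noncomputable def wedgePresheaf : X.AffineZariskiSiteᵒᵖ ⥤ CommRingCat.{u} where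
  obj U := .of (WedgeAlg k m (sectionsAlg f U.unop.toOpens))
  map i := CommRingCat.ofHom
    (WedgeAlg.map k m (sectionsRes f (Scheme.AffineZariskiSite.toOpens_mono i.unop.le))).toRingHom
  map_id U := by
    have h : WedgeAlg.map k m (sectionsRes f (le_refl U.unop.toOpens)) = AlgHom.id k _ := by
      refine WedgeAlg.hom_ext fun e a ↦ ?_
      rw [WedgeAlg.map_d, sectionsRes_refl]
      rfl
    exact congr(CommRingCat.ofHom ($h).toRingHom)
  map_comp {U V W} i j := by
    have hi := Scheme.AffineZariskiSite.toOpens_mono i.unop.le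
    have hj := Scheme.AffineZariskiSite.toOpens_mono j.unop.le
    have h : WedgeAlg.map k m (sectionsRes f (hj.trans hi)) =
        (WedgeAlg.map k m (sectionsRes f hj)).comp (WedgeAlg.map k m (sectionsRes f hi)) := by
      refine WedgeAlg.hom_ext fun e a ↦ ?_
      rw [WedgeAlg.map_d, AlgHom.comp_apply, WedgeAlg.map_d, WedgeAlg.map_d, sectionsRes_trans]
    exact congr(CommRingCat.ofHom ($h).toRingHom)

/-- The structure map from the structure sheaf of `X`. -/
noncomputable def wedgePresheafBase :
    (Scheme.AffineZariskiSite.toOpensFunctor X).op ⋙ X.presheaf ⟶ wedgePresheaf f m where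
  app U := CommRingCat.ofHom (WedgeAlg.base k m (sectionsAlg f U.unop.toOpens)).toRingHom
  naturality U V i := by
    ext a
    exact (WedgeAlg.map_d
      (sectionsRes f (Scheme.AffineZariskiSite.toOpens_mono i.unop.le)) 0 a).symm

theorem coequifibered_wedgePresheafBase : (wedgePresheafBase f m).Coequifibered := by
  rw [Scheme.AffineZariskiSite.coequifibered_iff_forall_isLocalizationAway]
  intro U g
  exact WedgeAlg.isLocalization_away (sectionsRes f (X.basicOpen_le g)) g
    (U.2.isLocalization_basicOpen g)

/-- The `m`-th wedge scheme `W_m(X)` of a `k`-scheme `f : X ⟶ Spec k`: it is glued from the affine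
schemes `W_m(U) = Spec (WedgeAlg k m Γ(X, U))`, where `U` runs through the affine open subsets
of `X`. -/
noncomputable def wedgeScheme : Scheme.{u} :=
  (Scheme.AffineZariskiSite.relativeGluingData (coequifibered_wedgePresheafBase f m)).glued

/-- The natural projection `π_m : W_m(X) ⟶ X`. -/
noncomputable def wedgeProj : wedgeScheme f m ⟶ X :=
  (Scheme.AffineZariskiSite.relativeGluingData (coequifibered_wedgePresheafBase f m)).toBase

end Glue

/-! ### The notions in the theorem -/

/-- A scheme `f : X ⟶ Spec k` over a field `k` is locally a complete intersection if every point
of `X` has an open neighbourhood that is isomorphic over `k` to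
`Spec k[x_1, …, x_N]/(g_1, …, g_c)`, for some `N`, `c` and `g_1, …, g_c` such that this ring has
Krull dimension `N - c`. -/
def IsLocallyCompleteIntersection {k : Type u} [Field k] {X : Scheme.{u}}
    (f : X ⟶ Spec (.of k)) : Prop :=
  ∀ x : X, ∃ (U : X.Opens) (N c : ℕ) (g : Fin c → MvPolynomial (Fin N) k),
    x ∈ U ∧
    ringKrullDim (MvPolynomial (Fin N) k ⧸ Ideal.span (Set.range g)) + c = N ∧
    ∃ e : (U : Scheme.{u}) ≅ Spec (.of (MvPolynomial (Fin N) k ⧸ Ideal.span (Set.range g))),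
      e.hom ≫ Spec.map (CommRingCat.ofHom
        (algebraMap k (MvPolynomial (Fin N) k ⧸ Ideal.span (Set.range g)))) = U.ι ≫ f

/-- A topological space is pure dimensional if all its irreducible components have the same
(finite) dimension. -/
def IsPureDimensional (T : Type*) [TopologicalSpace T] : Prop :=
  ∃ d : ℕ, ∀ Z ∈ irreducibleComponents T, topologicalKrullDim Z = d

/-- The singular locus of `f : X ⟶ Spec k`: the complement of the largest open subset of `X` that
is smooth over `k`. -/
def singularLocus {k : Type u} [Field k] {X : Scheme.{u}} (f : X ⟶ Spec (.of k)) : Set X :=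
  {x | ¬ ∃ U : X.Opens, x ∈ U ∧ Smooth (U.ι ≫ f)}

end WedgeScheme

namespace WedgeScheme

/-! ### Heights of maximal ideals in finitely generated algebras over a field -/

/-! Let `r = (m+1)(m+2)/2` be the number of monomials in `s, t` of degree at most `m`, and put `D =
n * r`. Where `X` is given by `c` equations in affine `(n+c)`-space, expanding coefficients presents
the wedge scheme by `c * r` equations in affine `(n+c) * r`-space (`WedgeAlg.presentation`). Krull's
height theorem then bounds the height of every maximal ideal of such a chart below by `D`, so every
nonempty open subset, and hence every irreducible component, has dimension at least `D`
(`le_topologicalKrullDim_of_isOpen_wedgeScheme`).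

Over the smooth locus, `X` is locally étale over an affine space. Infinitesimal lifting makes the
wedge scheme locally a product of `X` with an affine space
(`WedgeAlg.nonempty_equiv_of_formallyEtale`), so the preimage `R` of the smooth locus is irreducible
and contains a nonempty open set of dimension `D`. It is nonempty because an integral scheme of
finite type over a perfect field is smooth at its generic point.

The closure of `R` is therefore one component, of dimension exactly `D`, and all other components
lie over the singular locus and have dimension at least `D`. Pure dimensionality thus forces all
dimensions to be `D`, and other components are excluded precisely when the preimage of the singular
locus has dimension less than `D`
(`IsLocallySpecOfFiniteType.pureDimensional_iff_and_irreducible_iff`). When the total dimension is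
`D`, the presentations above have the dimension predicted by their number of equations, so the
charts are complete intersections. -/

theorem height_eq_of_isMaximal_mvPolynomial_fin (k : Type*) [Field k] (n : ℕ)
    (M : Ideal (MvPolynomial (Fin n) k)) [M.IsMaximal] : M.height = n := by
  induction n with
  | zero =>
    have e := MvPolynomial.isEmptyRingEquiv k (Fin 0)
    have hf : IsField (MvPolynomial (Fin 0) k) := e.toMulEquiv.isField (Field.toIsField k)
    let := hf.toField
    have hM : M = ⊥ := Ideal.eq_bot_of_prime M
    subst hM
    simp
  | succ n ih =>
    let e := (MvPolynomial.finSuccEquiv k n).toRingEquiv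
    let M' : Ideal (Polynomial (MvPolynomial (Fin n) k)) := M.map e
    have hM' : M'.IsMaximal := Ideal.map_isMaximal_of_equiv e
    -- Maximality of the contraction is the Jacobson property; the extra variable then raises the
    -- height by exactly one.
    have hp : (M'.under (MvPolynomial (Fin n) k)).IsMaximal :=
      Polynomial.isMaximal_comap_C_of_isJacobsonRing M'
    rw [← e.height_map M]
    change M'.height = _
    have : M'.LiesOver (M'.under (MvPolynomial (Fin n) k)) := ⟨rfl⟩
    rw [Polynomial.height_eq_height_add_one (M'.under (MvPolynomial (Fin n) k)) M',
      ih (M'.under (MvPolynomial (Fin n) k))]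
    simp

theorem height_eq_of_isMaximal_mvPolynomial (k : Type*) [Field k] {σ : Type*} [Finite σ]
    (M : Ideal (MvPolynomial σ k)) [M.IsMaximal] : M.height = Nat.card σ := by
  let e := (MvPolynomial.renameEquiv k (Finite.equivFin σ)).toRingEquiv
  have : (M.map e).IsMaximal := Ideal.map_isMaximal_of_equiv e
  rw [← e.height_map M, height_eq_of_isMaximal_mvPolynomial_fin]

/-- By incomparability, strict inclusions of primes stay strict after contraction along an integral
map. -/
theorem ringKrullDim_le_of_isIntegral (R S : Type*) [CommRing R] [CommRing S] [Algebra R S]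
    [Algebra.IsIntegral R S] : ringKrullDim S ≤ ringKrullDim R := by
  refine Order.krullDim_le_of_strictMono (PrimeSpectrum.comap (algebraMap R S)) fun I J h ↦ ?_
  obtain ⟨x, hxJ, hxI⟩ := SetLike.exists_of_lt (PrimeSpectrum.asIdeal_lt_asIdeal _ _ |>.mpr h)
  rw [← PrimeSpectrum.asIdeal_lt_asIdeal]
  exact Ideal.comap_lt_comap_of_integral_mem_sdiff (le_of_lt h) ⟨hxJ, hxI⟩
    (Algebra.IsIntegral.isIntegral x)

/-- All maximal ideals of a finitely generated domain have the same height. -/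
theorem height_eq_ringKrullDim_of_isMaximal (k : Type*) [Field k] (A : Type*) [CommRing A]
    [IsDomain A] [Algebra k A] [Algebra.FiniteType k A] (M : Ideal A) [M.IsMaximal] :
    (M.height : WithBot ℕ∞) = ringKrullDim A := by
  refine le_antisymm (Ideal.height_le_ringKrullDim_of_ne_top Ideal.IsPrime.ne_top') ?_
  have : IsNoetherianRing A := Algebra.FiniteType.isNoetherianRing k A
  -- Noether normalization: integrality gives `dim A ≤ s`, while going down over the polynomial ring
  -- gives `s ≤ M.height`.
  obtain ⟨s, g, hg, hfin⟩ := exists_finite_inj_algHom_of_fg k A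
  algebraize [g.toRingHom]
  have : Module.Finite (MvPolynomial (Fin s) k) A := hfin
  have : FaithfulSMul (MvPolynomial (Fin s) k) A :=
    (faithfulSMul_iff_algebraMap_injective _ _).mpr hg
  have : (M.under (MvPolynomial (Fin s) k)).IsMaximal :=
    Ideal.isMaximal_comap_of_isIntegral_of_isMaximal M
  have h1 := ringKrullDim_le_of_isIntegral (MvPolynomial (Fin s) k) A
  have h2 := Ideal.height_eq_height_add_of_liesOver_of_hasGoingDown
    (M.under (MvPolynomial (Fin s) k)) M
  rw [height_eq_of_isMaximal_mvPolynomial_fin] at h2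
  rw [MvPolynomial.ringKrullDim_of_isNoetherianRing, ringKrullDim_eq_zero_of_field, zero_add] at h1
  refine h1.trans ?_
  rw [h2, Nat.card_fin]
  exact_mod_cast (le_self_add : (s : ℕ∞) ≤ s + _)

/-- The maximal ideals of a quotient of a polynomial ring in `σ` indeterminates by `c` equations
have height at least `σ - c`. -/
theorem natCard_le_height_add_of_isMaximal_quotient (k : Type*) [Field k] {σ ι : Type*} [Finite σ]
    [Finite ι] (g : ι → MvPolynomial σ k)
    (M : Ideal (MvPolynomial σ k ⧸ Ideal.span (Set.range g))) [M.IsMaximal] :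
    (Nat.card σ : ℕ∞) ≤ M.height + Nat.card ι := by
  set N := M.comap (Ideal.Quotient.mk (Ideal.span (Set.range g)))
  have hN : N.IsMaximal :=
    Ideal.comap_isMaximal_of_surjective _ Ideal.Quotient.mk_surjective
  have hIN : Ideal.span (Set.range g) ≤ N := by
    rw [← Ideal.mk_ker (I := Ideal.span (Set.range g))]
    exact Ideal.comap_mono bot_le
  have hM : N.map (Ideal.Quotient.mk _) = M :=
    Ideal.map_comap_of_surjective _ Ideal.Quotient.mk_surjective M
  -- Krull's height theorem: dividing by the equations lowers the height by at most their number.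
  have h := Ideal.height_le_height_add_encard_of_subset (Set.range g) (p := N)
    (Ideal.subset_span.trans hIN)
  rw [height_eq_of_isMaximal_mvPolynomial] at h
  refine h.trans ?_
  rw [hM]
  gcongr
  rw [← Set.image_univ]
  refine (Set.encard_image_le _ _).trans ?_
  rw [Set.encard_univ, ENat.card_eq_coe_natCard]

/-! ### Krull dimension of topological spaces -/

section Topology

open TopologicalSpace Topology

/-- The height of `p` is the coheight of its closure among irreducible closed sets, and coheights
are unchanged by restriction to an open set containing `p`. -/
theorem height_le_topologicalKrullDim {A : Type*} [CommRing A] (O : Set (PrimeSpectrum A))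
    (hO : IsOpen O) (p : PrimeSpectrum A) (hp : p ∈ O) :
    (p.asIdeal.height : WithBot ℕ∞) ≤ topologicalKrullDim O := by
  have hj : IsOpenEmbedding (Subtype.val : O → PrimeSpectrum A) := hO.isOpenEmbedding_subtypeVal
  have h1 : p.asIdeal.height =
      Order.coheight (OrderDual.ofDual (PrimeSpectrum.pointsEquivIrreducibleCloseds A p)) := by
    rw [PrimeSpectrum.height_eq_orderHeight, ← Order.height_toDual, OrderDual.toDual_ofDual,
      Order.height_orderIso]
  have h2 : IrreducibleCloseds.map Subtype.val hj.continuous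
      (⟨closure {⟨p, hp⟩}, isIrreducible_singleton.closure, isClosed_closure⟩ :
        IrreducibleCloseds O) =
      OrderDual.ofDual (PrimeSpectrum.pointsEquivIrreducibleCloseds A p) := by
    ext1
    simp only [IrreducibleCloseds.coe_map, IrreducibleCloseds.coe_mk]
    rw [closure_image_closure hj.continuous, Set.image_singleton]
    rfl
  rw [h1, ← h2, hj.coheight_map]
  exact Order.coheight_le_krullDim _

/-- The dimension is a supremum of coheights, and the coheight of `Z` can be computed in any open
set meeting `Z`. -/
theorem topologicalKrullDim_le_of_cover {T : Type*} [TopologicalSpace T] {b : WithBot ℕ∞}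
    (h : ∀ x : T, ∃ O : Set T, x ∈ O ∧ IsOpen O ∧ topologicalKrullDim O ≤ b) :
    topologicalKrullDim T ≤ b := by
  rw [topologicalKrullDim, Order.krullDim_eq_iSup_coheight]
  refine iSup_le fun Z ↦ ?_
  obtain ⟨x, hx⟩ := Z.isIrreducible.nonempty
  obtain ⟨O, hxO, hO, hb⟩ := h x
  refine le_trans ?_ hb
  have hj : IsOpenEmbedding (Subtype.val : O → T) := hO.isOpenEmbedding_subtypeVal
  have hne : (Subtype.val ⁻¹' (Z : Set T) : Set O).Nonempty := ⟨⟨x, hxO⟩, hx⟩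
  have h2 : IrreducibleCloseds.map Subtype.val hj.continuous
      ((IrreducibleCloseds.orderIsoOfIsOpenEmbedding _ hj).symm ⟨Z, hne⟩) = Z :=
    congr(Subtype.val $((IrreducibleCloseds.orderIsoOfIsOpenEmbedding _ hj).apply_symm_apply
      ⟨Z, hne⟩))
  rw [← h2, hj.coheight_map]
  exact Order.coheight_le_krullDim _

theorem topologicalKrullDim_mono {T : Type*} [TopologicalSpace T] {s t : Set T} (h : s ⊆ t) :
    topologicalKrullDim s ≤ topologicalKrullDim t :=
  (IsEmbedding.inclusion h).isInducing.topologicalKrullDim_le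

theorem isIrreducible_preimage_val {T : Type*} [TopologicalSpace T] {C S : Set T} (h : S ⊆ C)
    (hS : IsIrreducible S) : IsIrreducible (Subtype.val ⁻¹' S : Set C) := by
  obtain ⟨x, hx⟩ := hS.nonempty
  refine ⟨⟨⟨x, h hx⟩, hx⟩, ?_⟩
  rintro _ _ ⟨u, hu, rfl⟩ ⟨v, hv, rfl⟩ ⟨y, hy, hyu⟩ ⟨z, hz, hzv⟩
  obtain ⟨w, hw, hwu, hwv⟩ := hS.isPreirreducible u v hu hv ⟨y, hy, hyu⟩ ⟨z, hz, hzv⟩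
  exact ⟨⟨w, h hw⟩, hw, hwu, hwv⟩

/-- A chain of irreducible closed sets lies entirely in any component containing its largest member.
-/
theorem topologicalKrullDim_le_of_irreducibleComponents {T : Type*} [TopologicalSpace T]
    {b : WithBot ℕ∞} (h : ∀ Z ∈ irreducibleComponents T, topologicalKrullDim Z ≤ b) :
    topologicalKrullDim T ≤ b := by
  refine iSup_le fun l ↦ ?_
  obtain ⟨C, hC, hlC⟩ := exists_mem_irreducibleComponents_subset_of_isIrreducible _
    l.last.isIrreducible
  refine le_trans ?_ (h C hC)
  have hl (i) : (l i : Set T) ⊆ C :=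
    (SetLike.coe_subset_coe.mpr (l.monotone (Fin.le_last i))).trans hlC
  let F : Fin (l.length + 1) → IrreducibleCloseds C := fun i ↦
    ⟨Subtype.val ⁻¹' (l i : Set T), isIrreducible_preimage_val (hl i) (l i).isIrreducible,
      (l i).isClosed.preimage continuous_subtype_val⟩
  have hF (i) (x : C) : x ∈ F i ↔ x.1 ∈ l i := Iff.rfl
  let l' : LTSeries (IrreducibleCloseds C) := LTSeries.mk l.length F (by
    intro i j hij
    have hlt := l.strictMono hij
    refine lt_of_le_of_ne (fun x hx ↦ ?_) fun e ↦ hlt.not_ge fun x hx ↦ ?_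
    · exact SetLike.coe_subset_coe.mpr hlt.le hx
    · have hx' : (⟨x, hl j hx⟩ : C) ∈ F j := hx
      rwa [← e] at hx')
  exact Order.LTSeries.length_le_krullDim l'

/-- A proper closed subset of an irreducible space of dimension `D` has dimension `< D`. -/
theorem topologicalKrullDim_lt_of_isClosed {T : Type*} [TopologicalSpace T] [IrreducibleSpace T]
    {C : Set T} (hC : IsClosed C) (hne : C ≠ Set.univ) {D : ℕ} (hD : topologicalKrullDim T = D) :
    topologicalKrullDim C < D := by
  by_contra! h
  obtain ⟨l, hl⟩ := Order.le_krullDim_iff.mp h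
  let l' := l.map _ (IrreducibleCloseds.map_strictMono_of_isInducing
    (IsInducing.subtypeVal (t := C)))
  -- The whole space can be appended to a chain of length `D` inside `C`, giving a chain of length
  -- `D + 1`.
  let t : IrreducibleCloseds T :=
    ⟨Set.univ, IrreducibleSpace.isIrreducible_univ T, isClosed_univ⟩
  have hlt : l'.last < t := by
    have hsub : (l'.last : Set T) ⊆ C := by
      simp only [l', LTSeries.last_map, IrreducibleCloseds.coe_map]
      exact closure_minimal (by simp) hC
    refine lt_of_le_of_ne (fun x _ ↦ Set.mem_univ x) fun e ↦ hne ?_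
    rw [e] at hsub
    exact Set.univ_subset_iff.mp hsub
  have := Order.LTSeries.length_le_krullDim (l'.snoc t hlt)
  have h2 : (l'.snoc t hlt).length = D + 1 := by simp [l', hl]
  rw [h2] at this
  have h3 : ((D + 1 : ℕ) : WithBot ℕ∞) ≤ (D : ℕ) := this.trans hD.le
  have h4 : D + 1 ≤ D := by exact_mod_cast h3
  omega

end Topology

/-! ### Spaces that are locally spectra of finitely generated algebras -/

section Topology

open TopologicalSpace Topology

/-- `T` is covered by open subsets homeomorphic to spectra of finitely generated `k`-algebras. -/
def IsLocallySpecOfFiniteType (k : Type u) [Field k] (T : Type u) [TopologicalSpace T] : Prop :=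
  ∀ x : T, ∃ (A : Type u) (_ : CommRing A) (_ : Algebra k A) (_ : Algebra.FiniteType k A)
    (j : PrimeSpectrum A → T), IsOpenEmbedding j ∧ x ∈ Set.range j

variable {k : Type u} [Field k] {T : Type u} [TopologicalSpace T]

/-- On a chart `Spec A`, the trace of `Z` is the zero locus of a prime `P`, so `A ⧸ P` is the
required domain. -/
theorem IsLocallySpecOfFiniteType.exists_isEmbedding (hT : IsLocallySpecOfFiniteType k T)
    {Z : Set T} (hZ : IsIrreducible Z) (hZc : IsClosed Z) {x : T} (hx : x ∈ Z) :
    ∃ (B : Type u) (_ : CommRing B) (_ : IsDomain B) (_ : Algebra k B)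
      (_ : Algebra.FiniteType k B) (j : PrimeSpectrum B → T) (O : Set T),
      IsEmbedding j ∧ IsOpen O ∧ x ∈ O ∧ Set.range j = Z ∩ O := by
  obtain ⟨A, _, _, _, j, hj, hxj⟩ := hT x
  have hirr : IsIrreducible (j ⁻¹' Z) := hZ.preimage hj ⟨x, hx, hxj⟩
  have hcl : IsClosed (j ⁻¹' Z) := hZc.preimage hj.continuous
  let P := PrimeSpectrum.vanishingIdeal (j ⁻¹' Z)
  have hP : P.IsPrime := PrimeSpectrum.isIrreducible_iff_vanishingIdeal_isPrime.mp hirr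
  have hPZ : PrimeSpectrum.zeroLocus (P : Set A) = j ⁻¹' Z := by
    rw [PrimeSpectrum.zeroLocus_vanishingIdeal_eq_closure, hcl.closure_eq]
  have hsurj : Function.Surjective (Ideal.Quotient.mk P) := Ideal.Quotient.mk_surjective
  refine ⟨A ⧸ P, inferInstance, inferInstance, inferInstance, inferInstance,
    j ∘ PrimeSpectrum.comap (Ideal.Quotient.mk P), Set.range j, ?_, hj.isOpen_range, hxj, ?_⟩
  · exact hj.isEmbedding.comp
      (PrimeSpectrum.isClosedEmbedding_comap_of_surjective _ _ hsurj).isEmbedding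
  · rw [Set.range_comp, range_comap_of_surjective _ _ hsurj, Ideal.mk_ker, hPZ,
      Set.image_preimage_eq_inter_range]

/-- In the spectrum of a Jacobson ring, every nonempty open set contains a maximal ideal, so a bound
at maximal ideals suffices. -/
theorem le_topologicalKrullDim_of_isOpen {A : Type*} [CommRing A] [IsJacobsonRing A]
    {D : WithBot ℕ∞} (h : ∀ (M : Ideal A), M.IsMaximal → D ≤ M.height)
    {O : Set (PrimeSpectrum A)} (hO : IsOpen O) (hne : O.Nonempty) :
    D ≤ topologicalKrullDim O := by
  have : JacobsonSpace (PrimeSpectrum A) := PrimeSpectrum.isJacobsonRing_iff_jacobsonSpace.mp ‹_›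
  obtain ⟨p, hp, hpc⟩ := nonempty_inter_closedPoints hne hO.isLocallyClosed
  exact (h _ ((PrimeSpectrum.isClosed_singleton_iff_isMaximal p).mp hpc)).trans
    (height_le_topologicalKrullDim O hO p hp)

theorem _root_.Topology.IsEmbedding.topologicalKrullDim_preimage_le {S T : Type*}
    [TopologicalSpace S] [TopologicalSpace T] {j : S → T} (hj : IsEmbedding j) (s : Set T) :
    topologicalKrullDim (j ⁻¹' s) ≤ topologicalKrullDim (s ∩ Set.range j : Set T) := by
  have h : IsInducing fun x : j ⁻¹' s ↦ (⟨j x.1, x.2, ⟨x.1, rfl⟩⟩ : (s ∩ Set.range j : Set T)) :=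
    IsInducing.subtypeVal.of_comp_iff.mp (hj.isInducing.comp IsInducing.subtypeVal)
  exact h.topologicalKrullDim_le

/-- By irreducibility, `V` meets every chart of `Z`. Such a chart is the spectrum of a finitely
generated domain, all of whose maximal ideals have full height, so its nonempty open subsets have
full dimension. -/
theorem IsLocallySpecOfFiniteType.topologicalKrullDim_inter (hT : IsLocallySpecOfFiniteType k T)
    {Z : Set T} (hZ : IsIrreducible Z) (hZc : IsClosed Z) {V : Set T} (hV : IsOpen V)
    (hne : (Z ∩ V).Nonempty) :
    topologicalKrullDim (Z ∩ V : Set T) = topologicalKrullDim Z := by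
  refine le_antisymm (topologicalKrullDim_mono Set.inter_subset_left) ?_
  refine topologicalKrullDim_le_of_cover fun x ↦ ?_
  obtain ⟨B, _, _, _, _, j, O, hj, hO, hxO, hr⟩ := hT.exists_isEmbedding hZ hZc x.2
  have hJ : IsJacobsonRing B := isJacobsonRing_of_finiteType (A := k)
  refine ⟨Subtype.val ⁻¹' O, hxO, hO.preimage continuous_subtype_val, ?_⟩
  have h1 : topologicalKrullDim (Subtype.val ⁻¹' O : Set Z) ≤ ringKrullDim B := by
    rw [← PrimeSpectrum.topologicalKrullDim_eq_ringKrullDim,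
      IsHomeomorph.topologicalKrullDim_eq _ hj.toHomeomorph.isHomeomorph, hr]
    refine (IsEmbedding.subtypeVal.topologicalKrullDim_preimage_le O).trans ?_
    rw [Subtype.range_coe, Set.inter_comm]
  refine h1.trans ?_
  have h2 : (j ⁻¹' V).Nonempty := by
    obtain ⟨y, hyZ, hyO, hyV⟩ := hZ.isPreirreducible O V hO hV ⟨x, x.2, hxO⟩ hne
    obtain ⟨z, rfl⟩ := hr.ge ⟨hyZ, hyO⟩
    exact ⟨z, hyV⟩
  have h3 := le_topologicalKrullDim_of_isOpen (D := ringKrullDim B)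
    (fun M hM ↦ (height_eq_ringKrullDim_of_isMaximal k B M).ge) (hV.preimage hj.continuous) h2
  refine h3.trans ((hj.topologicalKrullDim_preimage_le V).trans (topologicalKrullDim_mono ?_))
  rw [hr]
  exact fun y hy ↦ ⟨hy.2.1, hy.1⟩

/-- A noetherian chart has finitely many components; removing all but one leaves a nonempty open set
contained in `Z`, to which `h` applies. -/
theorem IsLocallySpecOfFiniteType.le_topologicalKrullDim_irreducibleComponent
    (hT : IsLocallySpecOfFiniteType k T) {D : WithBot ℕ∞}
    (h : ∀ O : Set T, IsOpen O → O.Nonempty → D ≤ topologicalKrullDim O)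
    {Z : Set T} (hZ : Z ∈ irreducibleComponents T) : D ≤ topologicalKrullDim Z := by
  obtain ⟨x, hx⟩ := (show IsIrreducible Z from hZ.1).nonempty
  obtain ⟨A, _, _, _, j, hj, hxj⟩ := hT x
  have : IsNoetherianRing A := Algebra.FiniteType.isNoetherianRing k A
  have hZ' := preimage_mem_irreducibleComponents hZ hj ⟨x, hx, hxj⟩
  have hfin := NoetherianSpace.finite_irreducibleComponents (α := PrimeSpectrum A)
  have hcl := closure_sUnion_irreducibleComponents_sdiff_singleton hfin _ hZ'
  set U := (⋃₀ (irreducibleComponents (PrimeSpectrum A) \ {j ⁻¹' Z}))ᶜ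
  have hU : IsOpen U := by
    rw [isOpen_compl_iff, Set.sUnion_eq_biUnion]
    exact hfin.sdiff.isClosed_biUnion fun W hW ↦ isClosed_of_mem_irreducibleComponents W hW.1
  have hUne : U.Nonempty := by
    rw [← closure_nonempty_iff, hcl]
    exact (show IsIrreducible (j ⁻¹' Z) from hZ'.1).nonempty
  refine (h _ (hj.isOpenMap U hU) (hUne.image j)).trans (topologicalKrullDim_mono ?_)
  rw [Set.image_subset_iff, ← hcl]
  exact subset_closure

/-- The topological part of the theorem. -/
theorem IsLocallySpecOfFiniteType.pureDimensional_iff_and_irreducible_iff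
    (hT : IsLocallySpecOfFiniteType k T) {D : ℕ}
    (h : ∀ O : Set T, IsOpen O → O.Nonempty → D ≤ topologicalKrullDim O)
    {R V : Set T} (hR : IsOpen R) (hRi : IsIrreducible R) (hV : IsOpen V) (hVR : V ⊆ R)
    (hVne : V.Nonempty) (hVD : topologicalKrullDim V = D) :
    (IsPureDimensional T ↔ topologicalKrullDim T = D) ∧
      (IrreducibleSpace T ↔ topologicalKrullDim (Rᶜ : Set T) < D) := by
  have hcl : topologicalKrullDim (closure R) = D := by
    have hsub : V ⊆ closure R := hVR.trans subset_closure
    rw [← hT.topologicalKrullDim_inter hRi.closure isClosed_closure hV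
      (by rwa [Set.inter_eq_right.mpr hsub]), Set.inter_eq_right.mpr hsub, hVD]
  -- If `Z` meets the open set `R`, then `Z ∩ R` is dense in `Z`, so `Z ⊆ closure R`, and maximality
  -- gives equality.
  have hcomp : ∀ Z ∈ irreducibleComponents T, (Z ∩ R).Nonempty → Z = closure R := by
    intro Z hZ hne
    have hZc := isClosed_of_mem_irreducibleComponents Z hZ
    have hZi : IsIrreducible Z := hZ.1
    have h1 : Z ⊆ closure (Z ∩ R) := by
      intro x hx
      rw [mem_closure_iff]
      intro o ho hxo
      obtain ⟨y, hy⟩ := hZi.isPreirreducible o R ho hR ⟨x, hx, hxo⟩ hne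
      exact ⟨y, hy.2.1, hy.1, hy.2.2⟩
    have h2 : Z ⊆ closure R := h1.trans (closure_mono Set.inter_subset_right)
    exact h2.antisymm (hZ.2 hRi.closure h2)
  have hRcomp : closure R ∈ irreducibleComponents T := by
    obtain ⟨Z, hZ, hsub⟩ := exists_mem_irreducibleComponents_subset_of_isIrreducible R hRi
    obtain ⟨x, hx⟩ := hVne
    rwa [← hcomp Z hZ ⟨x, hsub (hVR hx), hVR hx⟩]
  refine ⟨⟨?_, ?_⟩, ?_, ?_⟩
  · rintro ⟨d, hd⟩
    -- The component `closure R` pins the common dimension down to `D`.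
    have hdD : (d : WithBot ℕ∞) = D := by rw [← hd _ hRcomp, hcl]
    refine le_antisymm ?_ (h _ isOpen_univ ⟨_, Set.mem_univ hVne.some⟩ |>.trans
      (topologicalKrullDim_subspace_le T _))
    exact topologicalKrullDim_le_of_irreducibleComponents fun Z hZ ↦ (hd Z hZ).le.trans hdD.le
  · intro hD
    refine ⟨D, fun Z hZ ↦ le_antisymm ?_ (hT.le_topologicalKrullDim_irreducibleComponent h hZ)⟩
    exact (topologicalKrullDim_subspace_le T Z).trans hD.le
  · intro hirr
    have hdense : closure R = Set.univ :=
      (hR.dense (hVne.mono hVR)).closure_eq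
    refine topologicalKrullDim_lt_of_isClosed hR.isClosed_compl ?_ ?_
    · rw [Set.compl_ne_univ]
      exact hVne.mono hVR
    · rw [← hcl, hdense]
      exact (IsHomeomorph.topologicalKrullDim_eq _ (Homeomorph.Set.univ T).isHomeomorph).symm
  · intro hlt
    have huniv : closure R = Set.univ := by
      refine Set.eq_univ_of_forall fun x ↦ ?_
      rw [← hcomp _ (irreducibleComponent_mem_irreducibleComponents x) ?_]
      · exact mem_irreducibleComponent
      -- A component missing `R` would lie in `Rᶜ` and yet have dimension at least `D`.
      · by_contra hne
        have hsub : irreducibleComponent x ⊆ Rᶜ := fun y hy hyR ↦ hne ⟨y, hy, hyR⟩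
        exact ((hT.le_topologicalKrullDim_irreducibleComponent h
          (irreducibleComponent_mem_irreducibleComponents x)).trans
          (topologicalKrullDim_mono hsub)).not_gt hlt
    have := hRi.closure
    rw [huniv] at this
    exact irreducibleSpace_def T |>.mpr this

end Topology

/-! ### Presentations of `WedgeAlg` -/

/-- The exponents of the monomials that are nonzero in `R[s,t]/(s,t)^(m+1)`. -/
abbrev Exponent (m : ℕ) : Type := {e : Fin 2 →₀ ℕ // e.degree ≤ m}

/-- An exponent is determined by its degree and its first entry. -/
noncomputable def exponentEquiv (m : ℕ) : Exponent m ≃ Σ d : Fin (m + 1), Fin (d + 1) where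
  toFun e := ⟨⟨e.1.degree, by have := e.2; omega⟩, ⟨e.1 0, by
    have : e.1.degree = e.1 0 + e.1 1 := by simp [Finsupp.degree_eq_sum]
    simp only; omega⟩⟩
  invFun p := ⟨Finsupp.equivFunOnFinite.symm ![p.2, p.1 - p.2], by
    have := p.1.2
    have := p.2.2
    simp [Finsupp.degree_eq_sum]; omega⟩
  left_inv e := by
    ext i
    have : e.1.degree = e.1 0 + e.1 1 := by simp [Finsupp.degree_eq_sum]
    fin_cases i <;> simp [this]
  right_inv := by
    rintro ⟨⟨d, hd⟩, ⟨a, ha⟩⟩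
    have h : a + (d - a) = d := by simp only at ha; omega
    simp only [Sigma.mk.injEq, Fin.mk.injEq]
    have h' : (Finsupp.equivFunOnFinite.symm ![a, d - a] : Fin 2 →₀ ℕ).degree = d := by
      simp [Finsupp.degree_eq_sum, h]
    refine ⟨h', ?_⟩
    rw [Fin.heq_ext_iff (by simp [h'])]
    simp

instance (m : ℕ) : Finite (Exponent m) := .of_equiv _ (exponentEquiv m).symm

theorem natCard_exponent (m : ℕ) : Nat.card (Exponent m) = (m + 1) * (m + 2) / 2 := by
  rw [Nat.card_congr (exponentEquiv m), Nat.card_sigma]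
  simp only [Nat.card_fin]
  rw [Fin.sum_univ_eq_sum_range (fun d ↦ d + 1) (m + 1)]
  have h : ∀ m, (∑ d ∈ Finset.range (m + 1), (d + 1)) * 2 = (m + 1) * (m + 2) := by
    intro m
    induction m with
    | zero => rfl
    | succ m ih => rw [Finset.sum_range_succ, add_mul, ih]; ring
  have := h m
  omega

namespace WedgeAlg

variable {k : Type*} {m : ℕ} {A B R S : Type*} [CommRing k] [CommRing A] [Algebra k A]
  [CommRing B] [Algebra k B] [CommRing R] [Algebra k R] [CommRing S] [Algebra k S]

theorem hom_ext_exponent {φ ψ : WedgeAlg k m A →ₐ[k] S}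
    (h : ∀ (e : Exponent m) (a : A), φ (d k m e a) = ψ (d k m e a)) : φ = ψ := by
  refine hom_ext fun e a ↦ ?_
  by_cases he : e.degree ≤ m
  · exact h ⟨e, he⟩ a
  · rw [d_of_lt e (by omega), map_zero, map_zero]

/-- `WedgeAlg k m` sends isomorphisms to isomorphisms. -/
noncomputable def mapEquiv (k : Type*) (m : ℕ) {A B : Type*} [CommRing k] [CommRing A] [Algebra k A]
    [CommRing B] [Algebra k B] (g : A ≃ₐ[k] B) : WedgeAlg k m A ≃ₐ[k] WedgeAlg k m B :=
  AlgEquiv.ofAlgHom (map k m g.toAlgHom) (map k m g.symm.toAlgHom)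
    (hom_ext fun e a ↦ by simp) (hom_ext fun e a ↦ by simp)

/-- The truncated polynomial with given coefficients of degree at most `m`. -/
noncomputable def ofExponent (m : ℕ) {R : Type*} [CommRing R] (g : Exponent m → R) : Trunc m R :=
  ofCoeff m fun e ↦ if he : e.degree ≤ m then g ⟨e, he⟩ else 0

theorem coeff_ofExponent (g : Exponent m → R) (e : Exponent m) :
    Trunc.coeff e.1 (ofExponent m g) = g e := by
  rw [ofExponent, coeff_ofCoeff _ _ e.2, dif_pos e.2]

/-- The wedge scheme of an affine space is an affine space. -/
noncomputable def mvPolynomialEquiv (k : Type*) (m : ℕ) (σ : Type*) [CommRing k] :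
    WedgeAlg k m (MvPolynomial σ k) ≃ₐ[k] MvPolynomial (σ × Exponent m) k :=
  AlgEquiv.ofAlgHom
    (lift (MvPolynomial.aeval fun i ↦ ofExponent m fun e ↦ MvPolynomial.X (i, e)))
    (MvPolynomial.aeval fun p ↦ d k m p.2 (MvPolynomial.X p.1))
    (by
      ext ⟨i, e⟩
      simp [coeff_ofExponent])
    (by
      -- Under the universal property, endomorphisms are compared as maps out of the polynomial
      -- ring, hence on its variables.
      apply wedgeAlgHomEquiv.injective
      apply MvPolynomial.algHom_ext
      intro i
      refine Trunc.ext_coeff fun e he ↦ ?_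
      change Trunc.coeff e (unlift _ _) = Trunc.coeff e (unlift _ _)
      rw [coeff_unlift _ _ he, coeff_unlift _ _ he, AlgHom.comp_apply, lift_d,
        MvPolynomial.aeval_X, coeff_ofExponent _ ⟨e, he⟩, MvPolynomial.aeval_X]
      rfl)

/-- The wedge scheme of a closed subscheme of `Spec A` is cut out by the coefficients of its
equations. -/
noncomputable def quotientEquiv (k : Type*) (m : ℕ) {A ι : Type*} [CommRing k] [CommRing A]
    [Algebra k A] (g : ι → A) :
    (WedgeAlg k m A ⧸ Ideal.span (Set.range fun p : ι × Exponent m ↦ d k m p.2.1 (g p.1))) ≃ₐ[k]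
      WedgeAlg k m (A ⧸ Ideal.span (Set.range g)) :=
  let J := Ideal.span (Set.range fun p : ι × Exponent m ↦ d k m p.2.1 (g p.1))
  let q := Ideal.Quotient.mkₐ k (Ideal.span (Set.range g))
  let φ : (WedgeAlg k m A ⧸ J) →ₐ[k] WedgeAlg k m (A ⧸ Ideal.span (Set.range g)) :=
    Ideal.Quotient.liftₐ J (map k m q) (by
      change J ≤ RingHom.ker (map k m q)
      rw [Ideal.span_le]
      rintro _ ⟨p, rfl⟩
      have : q (g p.1) = 0 :=
        Ideal.Quotient.eq_zero_iff_mem.mpr (Ideal.subset_span (Set.mem_range_self _))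
      simp only [SetLike.mem_coe, RingHom.mem_ker, map_d, this]
      simpa using d_algebraMap (k := k) (m := m) (A := A ⧸ Ideal.span (Set.range g)) p.2.1 0)
  let α : A ⧸ Ideal.span (Set.range g) →ₐ[k] Trunc m (WedgeAlg k m A ⧸ J) :=
    Ideal.Quotient.liftₐ _ (unlift (Ideal.Quotient.mkₐ k J)) (by
      change Ideal.span (Set.range g) ≤ RingHom.ker (unlift (Ideal.Quotient.mkₐ k J))
      rw [Ideal.span_le]
      rintro _ ⟨i, rfl⟩
      refine Trunc.ext_coeff fun e he ↦ ?_
      rw [coeff_unlift _ _ he]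
      have h0 : Trunc.coeff e (0 : Trunc m (WedgeAlg k m A ⧸ J)) = 0 := by
        simpa using Trunc.coeff_algebraMap (k := k) (m := m) (R := WedgeAlg k m A ⧸ J) e 0
      rw [h0]
      -- All coefficients of the universal image of `g i` lie in `J` by construction, so that image
      -- vanishes.
      exact Ideal.Quotient.eq_zero_iff_mem.mpr (Ideal.subset_span ⟨(i, ⟨e, he⟩), rfl⟩))
  have hφ (e : Fin 2 →₀ ℕ) (a : A) : φ (Ideal.Quotient.mkₐ k J (d k m e a)) = d k m e (q a) :=
    map_d q e a
  have hα (e : Exponent m) (a : A) :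
      lift α (d k m e.1 (q a)) = Ideal.Quotient.mkₐ k J (d k m e.1 a) := by
    rw [lift_d]
    exact coeff_unlift _ _ e.2 a
  AlgEquiv.ofAlgHom φ (lift α)
    (hom_ext_exponent fun e a ↦ by
      obtain ⟨a, rfl⟩ := Ideal.Quotient.mk_surjective a
      exact (congrArg φ (hα e a)).trans (hφ e a))
    (by
      apply Ideal.Quotient.algHom_ext
      refine hom_ext_exponent fun e a ↦ ?_
      exact (congrArg (lift α) (hφ e a)).trans (hα e a))

/-- The equations of the wedge scheme of the closed subscheme of an affine space given by `g`. -/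
noncomputable def wedgeEquations (m : ℕ) {k σ ι : Type*} [CommRing k]
    (g : ι → MvPolynomial σ k) (p : ι × Exponent m) : MvPolynomial (σ × Exponent m) k :=
  mvPolynomialEquiv k m σ (d k m p.2.1 (g p.1))

/-- The wedge scheme of the closed subscheme of an affine space given by `g`. -/
noncomputable def presentation (m : ℕ) {k σ ι : Type*} [CommRing k] (g : ι → MvPolynomial σ k) :
    WedgeAlg k m (MvPolynomial σ k ⧸ Ideal.span (Set.range g)) ≃ₐ[k]
      MvPolynomial (σ × Exponent m) k ⧸ Ideal.span (Set.range (wedgeEquations m g)) :=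
  (quotientEquiv k m g).symm.trans (Ideal.quotientEquivAlg _ _ (mvPolynomialEquiv k m σ) (by
    rw [Ideal.map_span, ← Set.range_comp]
    rfl))

/-- The functor `WedgeAlg k m` preserves surjections, since the generators `d k m e a` lift, and it
takes a polynomial ring in finitely many variables to another one. -/
instance finiteType {k : Type*} {m : ℕ} {A : Type*} [CommRing k] [CommRing A] [Algebra k A]
    [Algebra.FiniteType k A] : Algebra.FiniteType k (WedgeAlg k m A) := by
  obtain ⟨n, f, hf⟩ := Algebra.FiniteType.iff_quotient_mvPolynomial''.mp ‹Algebra.FiniteType k A›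
  have hs : Function.Surjective (map k m f) := by
    intro x
    obtain ⟨p, rfl⟩ := Ideal.Quotient.mk_surjective x
    change mk k m A p ∈ (map k m f).range
    have : (mk k m A).range ≤ (map k m f).range := by
      rw [← Algebra.map_top, ← MvPolynomial.adjoin_range_X, AlgHom.map_adjoin, Algebra.adjoin_le_iff]
      rintro _ ⟨_, ⟨⟨a, e⟩, rfl⟩, rfl⟩
      obtain ⟨a, rfl⟩ := hf a
      exact ⟨d k m e a, map_d f e a⟩
    exact this ⟨p, rfl⟩
  exact .of_surjective ((map k m f).comp (mvPolynomialEquiv k m (Fin n)).symm.toAlgHom)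
    (hs.comp (mvPolynomialEquiv k m (Fin n)).symm.surjective)

end WedgeAlg

/-! ### Wedge schemes of étale schemes over an affine space -/

namespace Trunc

variable {m : ℕ} {R : Type*} [CommRing R]

/-- The augmentation `R[s,t]/(s,t)^(m+1) → R`. -/
noncomputable def coeffZero (m : ℕ) (R : Type*) [CommRing R] : Trunc m R →+* R where
  toFun := coeff 0
  map_one' := by simpa using coeff_algebraMap (k := R) (m := m) (R := R) 0 1
  map_zero' := by simpa using coeff_algebraMap (k := R) (m := m) (R := R) 0 0
  map_mul' x y := by simpa using coeff_mul 0 (by simp) x y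
  map_add' x y := coeff_add 0 x y

theorem coeffZero_apply (x : Trunc m R) : coeffZero m R x = coeff 0 x := rfl

theorem coeffZero_surjective : Function.Surjective (coeffZero m R) := fun r ↦
  ⟨algebraMap R _ r, by rw [coeffZero_apply, coeff_algebraMap]; simp⟩

/-- The kernel is contained in the image of `(s,t)`, whose `(m+1)`-st power is zero. This makes
infinitesimal lifting applicable. -/
theorem isNilpotent_ker_coeffZero : IsNilpotent (RingHom.ker (coeffZero m R)) := by
  have h : RingHom.ker (coeffZero m R) ≤
      (MvPolynomial.idealOfVars (Fin 2) R).map (Trunc.mk m) := by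
    intro x hx
    obtain ⟨p, rfl⟩ := Ideal.Quotient.mk_surjective x
    rw [RingHom.mem_ker, coeffZero_apply, coeff_mk 0 (by simp)] at hx
    refine Ideal.mem_map_of_mem _ ?_
    rw [← pow_one (MvPolynomial.idealOfVars (Fin 2) R), MvPolynomial.mem_pow_idealOfVars_iff']
    intro e he
    have : e = 0 := by rw [← Finsupp.degree_eq_zero_iff]; omega
    rw [this, hx]
  refine ⟨m + 1, le_bot_iff.mp ((Ideal.pow_right_mono h (m + 1)).trans ?_)⟩
  rw [← Ideal.map_pow, Ideal.map_quotient_self]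

end Trunc

namespace WedgeAlg

/-- Let `B` be étale over `k[x_i : i ∈ σ]`. Then the wedge scheme of `Spec B` is the product of
`Spec B` with an affine space, whose coordinates are the nonconstant coefficients of the images
of the `x_i`. -/
theorem nonempty_equiv_of_formallyEtale (k : Type*) (m : ℕ) (σ B : Type*) [CommRing k] [CommRing B]
    [Algebra k B] [Algebra (MvPolynomial σ k) B] [IsScalarTower k (MvPolynomial σ k) B]
    [Algebra.FormallyEtale (MvPolynomial σ k) B] :
    Nonempty (WedgeAlg k m B ≃ₐ[k] MvPolynomial (σ × {e : Exponent m // e.1 ≠ 0}) B) := by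
  classical
  let S := MvPolynomial (σ × {e : Exponent m // e.1 ≠ 0}) B
  let x (i : σ) : B := algebraMap (MvPolynomial σ k) B (MvPolynomial.X i)
  -- The universal wedge in affine space whose constant terms come from `B`: the higher coefficients
  -- are free variables.
  let θ : MvPolynomial σ k →ₐ[k] Trunc m S := MvPolynomial.aeval fun i ↦ ofExponent m fun e ↦
    if he : e.1 = 0 then MvPolynomial.C (x i) else MvPolynomial.X (i, ⟨e, he⟩)
  let c : B →ₐ[k] S := IsScalarTower.toAlgHom k B S
  -- Formal smoothness extends `θ` to `B`, lifting `c` through the nilpotent thickening `Trunc m S →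
  -- S`.
  obtain ⟨α, hα0, hαx⟩ : ∃ α : B →ₐ[k] Trunc m S, (∀ b, Trunc.coeff 0 (α b) = c b) ∧
      ∀ i, α (x i) = θ (MvPolynomial.X i) := by
    let := θ.toRingHom.toAlgebra
    let : Algebra (MvPolynomial σ k) S := (c.toRingHom.comp (algebraMap _ B)).toAlgebra
    let π : Trunc m S →ₐ[MvPolynomial σ k] S :=
      { Trunc.coeffZero m S with
        commutes' := by
          have h : ((Trunc.coeffZero m S).comp θ.toRingHom) =
              c.toRingHom.comp (algebraMap (MvPolynomial σ k) B) := by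
            apply MvPolynomial.ringHom_ext
            · intro r
              have h1 : θ (MvPolynomial.C r) = algebraMap k _ r := θ.commutes r
              have h2 : algebraMap (MvPolynomial σ k) B (MvPolynomial.C r) = algebraMap k B r :=
                (IsScalarTower.algebraMap_apply k (MvPolynomial σ k) B r).symm
              change Trunc.coeff 0 (θ (MvPolynomial.C r)) = c (algebraMap _ B (MvPolynomial.C r))
              rw [h1, h2, Trunc.coeff_algebraMap, if_pos rfl, c.commutes]
            · intro i
              change Trunc.coeff 0 (θ (MvPolynomial.X i)) = c (x i)
              simp only [θ, MvPolynomial.aeval_X]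
              rw [coeff_ofExponent _ (⟨0, by simp⟩ : Exponent m), dif_pos rfl]
              rfl
          exact fun p ↦ congr($h p) }
    let c' : B →ₐ[MvPolynomial σ k] S := { c.toRingHom with commutes' := fun _ ↦ rfl }
    let α' := Algebra.FormallySmooth.liftOfSurjective c' π Trunc.coeffZero_surjective
      Trunc.isNilpotent_ker_coeffZero
    refine ⟨{ α'.toRingHom with
      commutes' := fun r ↦ ?_ }, fun b ↦ ?_, fun i ↦ α'.commutes _⟩
    · rw [IsScalarTower.algebraMap_apply k (MvPolynomial σ k) B]
      exact (α'.commutes _).trans (θ.commutes r)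
    exact Algebra.FormallySmooth.liftOfSurjective_apply c' π Trunc.coeffZero_surjective
      Trunc.isNilpotent_ker_coeffZero b
  let Φ : WedgeAlg k m B →ₐ[k] S := lift α
  let _ : Algebra B (WedgeAlg k m B) := (base k m B).toRingHom.toAlgebra
  have : IsScalarTower k B (WedgeAlg k m B) := .of_algebraMap_eq' (base k m B).comp_algebraMap.symm
  let Ψ' : S →ₐ[B] WedgeAlg k m B := MvPolynomial.aeval fun p ↦ d k m p.2.1.1 (x p.1)
  let Ψ : S →ₐ[k] WedgeAlg k m B := Ψ'.restrictScalars k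
  have hΨc (b : B) : Ψ (c b) = d k m 0 b := Ψ'.commutes b
  have hΨX (i : σ) (e) : Ψ (MvPolynomial.X (i, e)) = d k m e.1.1 (x i) :=
    MvPolynomial.aeval_X _ _
  have hΦ0 (b : B) : Φ (d k m 0 b) = c b := by rw [lift_d, hα0]
  have hΦX (i : σ) (e : {e : Exponent m // e.1 ≠ 0}) :
      Φ (d k m e.1.1 (x i)) = MvPolynomial.X (i, e) := by
    rw [lift_d, hαx, MvPolynomial.aeval_X, coeff_ofExponent, dif_neg e.2]
  refine ⟨AlgEquiv.ofAlgHom Φ Ψ ?_ ?_⟩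
  · refine AlgHom.coe_ringHom_injective (MvPolynomial.ringHom_ext ?_ ?_)
    · intro b
      change Φ (Ψ (c b)) = c b
      rw [hΨc, hΦ0]
    · rintro ⟨i, e⟩
      change Φ (Ψ (MvPolynomial.X (i, e))) = MvPolynomial.X (i, e)
      rw [hΨX, hΦX]
  · apply wedgeAlgHomEquiv.injective
    change unlift (Ψ.comp Φ) = unlift (AlgHom.id k (WedgeAlg k m B))
    have key : (unlift (Ψ.comp Φ)).comp (IsScalarTower.toAlgHom k (MvPolynomial σ k) B) =
        (unlift (AlgHom.id k (WedgeAlg k m B))).comp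
          (IsScalarTower.toAlgHom k (MvPolynomial σ k) B) := by
      apply MvPolynomial.algHom_ext
      intro i
      refine Trunc.ext_coeff fun e he ↦ ?_
      change Trunc.coeff e (unlift _ (x i)) = Trunc.coeff e (unlift _ (x i))
      rw [coeff_unlift _ e he, coeff_unlift _ e he]
      change Ψ (Φ (d k m e (x i))) = d k m e (x i)
      by_cases h0 : e = 0
      · subst h0
        rw [hΦ0, hΨc]
      · exact (congrArg Ψ (hΦX i ⟨⟨e, he⟩, h0⟩)).trans (hΨX i _)
    let := ((unlift (Ψ.comp Φ)).comp (IsScalarTower.toAlgHom k (MvPolynomial σ k) B)).toAlgebra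
    let β₁ : B →ₐ[MvPolynomial σ k] Trunc m (WedgeAlg k m B) :=
      { (unlift (Ψ.comp Φ)).toRingHom with commutes' := fun _ ↦ rfl }
    let β₂ : B →ₐ[MvPolynomial σ k] Trunc m (WedgeAlg k m B) :=
      { (unlift (AlgHom.id k (WedgeAlg k m B))).toRingHom with
        commutes' := fun p ↦ congr($key.symm p) }
    -- Formal unramifiedness: the two lifts agree on the polynomial ring and modulo the nilpotent
    -- augmentation ideal.
    have hβ : β₁ = β₂ := by
      refine Algebra.FormallyUnramified.ext' (Trunc.coeffZero m (WedgeAlg k m B))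
        Trunc.isNilpotent_ker_coeffZero β₁ β₂ fun b ↦ ?_
      change Trunc.coeff 0 (unlift (Ψ.comp Φ) b) =
        Trunc.coeff 0 (unlift (AlgHom.id k (WedgeAlg k m B)) b)
      rw [coeff_unlift _ 0 (by simp), coeff_unlift _ 0 (by simp)]
      change Ψ (Φ (d k m 0 b)) = d k m 0 b
      rw [hΦ0, hΨc]
    exact AlgHom.ext fun b ↦ congr($hβ b)

end WedgeAlg

/-! ### The affine charts of the wedge scheme -/

section Charts

open TopologicalSpace Topology Limits

variable {k : Type u} [Field k] {X : Scheme.{u}} (f : X ⟶ Spec (.of k)) (m : ℕ)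

/-- This isolates the gluing construction: later arguments reach the wedge scheme through these
charts. -/
theorem exists_chart (U : X.Opens) (hU : IsAffineOpen U) :
    ∃ j : Spec (.of (WedgeAlg k m (sectionsAlg f U))) ⟶ wedgeScheme f m,
      ∃ _ : IsOpenImmersion j,
      j.opensRange = wedgeProj f m ⁻¹ᵁ U ∧
      j ≫ wedgeProj f m =
        Spec.map (CommRingCat.ofHom (WedgeAlg.base k m (sectionsAlg f U)).toRingHom) ≫
          hU.fromSpec := by
  let D := Scheme.AffineZariskiSite.relativeGluingData (coequifibered_wedgePresheafBase f m)
  let U' : X.AffineZariskiSite := ⟨U, hU⟩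
  have h1 : IsOpenImmersion (D.cover.f U') := D.cover.map_prop U'
  refine ⟨D.cover.f U', h1, ?_, ?_⟩
  · have := D.toBase_preimage_eq_opensRange_ι U'
    refine Eq.trans this.symm ?_
    change wedgeProj f m ⁻¹ᵁ _ = _
    congr 1
    exact U.opensRange_ι
  · refine (D.ι_toBase U').trans ?_
    rfl

theorem fromSpec_comp (U : X.Opens) (hU : IsAffineOpen U) :
    hU.fromSpec ≫ f = Spec.map (CommRingCat.ofHom (sectionsMap f U)) := by
  rw [← (isAffineOpen_top (Spec (.of k))).SpecMap_appLE_fromSpec f hU le_top,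
    IsAffineOpen.fromSpec_top, Scheme.isoSpec_Spec_inv, ← Spec.map_comp]
  rfl

instance finiteType_sectionsAlg [LocallyOfFiniteType f] (U : X.affineOpens) :
    Algebra.FiniteType k (sectionsAlg f U) := by
  rw [← RingHom.finiteType_algebraMap]
  exact (f.finiteType_appLE (isAffineOpen_top _) U.2 le_top).comp
    (.of_surjective _ (Scheme.ΓSpecIso (.of k)).symm.commRingCatIsoToRingEquiv.surjective)

/-- Full faithfulness of `Spec` turns the isomorphism of schemes over `k` into one of `k`-algebras.
-/
theorem nonempty_algEquiv_of_iso (U : X.Opens) (A : Type u) [CommRing A] [Algebra k A]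
    (e : (U : Scheme.{u}) ≅ Spec (.of A))
    (he : e.hom ≫ Spec.map (CommRingCat.ofHom (algebraMap k A)) = U.ι ≫ f) :
    IsAffineOpen U ∧ Nonempty (A ≃ₐ[k] sectionsAlg f U) := by
  have hU : IsAffineOpen U := .of_isIso e.hom
  refine ⟨hU, ?_⟩
  let i : Spec Γ(X, U) ≅ Spec (.of A) := hU.isoSpec.symm ≪≫ e
  let φ : CommRingCat.of A ⟶ Γ(X, U) := Spec.preimage i.hom
  have hφ : Spec.map φ = i.hom := Spec.map_preimage _
  have : IsIso (Scheme.Spec.map φ.op) := by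
    change IsIso (Spec.map φ)
    rw [hφ]
    infer_instance
  have : IsIso φ.op := isIso_of_reflects_iso φ.op Scheme.Spec
  have : IsIso φ := isIso_of_op φ
  have hk : CommRingCat.ofHom (algebraMap k A) ≫ φ = CommRingCat.ofHom (sectionsMap f U) := by
    apply Spec.map_injective
    rw [Spec.map_comp, hφ, ← fromSpec_comp f U hU]
    simp only [i, Iso.trans_hom, Iso.symm_hom, Category.assoc, he]
    rw [← Category.assoc, IsAffineOpen.isoSpec_inv_ι]
  exact ⟨AlgEquiv.ofRingEquiv (f := (asIso φ).commRingCatIsoToRingEquiv)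
    fun c ↦ congr($(congrArg CommRingCat.Hom.hom hk) c)⟩

theorem topologicalKrullDim_eq_ringKrullDim_of_isAffineOpen (U : X.Opens) (hU : IsAffineOpen U) :
    topologicalKrullDim U = ringKrullDim Γ(X, U) := by
  rw [← PrimeSpectrum.topologicalKrullDim_eq_ringKrullDim]
  exact IsHomeomorph.topologicalKrullDim_eq _ hU.isoSpec.hom.homeomorph.isHomeomorph

theorem isLocallySpecOfFiniteType [LocallyOfFiniteType f] : IsLocallySpecOfFiniteType k X := by
  intro x
  obtain ⟨_, ⟨U, hU, rfl⟩, hxU, -⟩ :=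
    X.isBasis_affineOpens.exists_subset_of_mem_open (Set.mem_univ x) isOpen_univ
  have := finiteType_sectionsAlg f ⟨U, hU⟩
  refine ⟨sectionsAlg f U, inferInstance, inferInstance, this, hU.fromSpec,
    hU.isOpenImmersion_fromSpec.base_open, ?_⟩
  exact hU.range_fromSpec.ge hxU

theorem isLocallySpecOfFiniteType_wedgeScheme [LocallyOfFiniteType f] :
    IsLocallySpecOfFiniteType k (wedgeScheme f m) := by
  intro x
  obtain ⟨_, ⟨U, hU, rfl⟩, hxU, -⟩ :=
    X.isBasis_affineOpens.exists_subset_of_mem_open (Set.mem_univ (wedgeProj f m x)) isOpen_univ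
  have := finiteType_sectionsAlg f ⟨U, hU⟩
  obtain ⟨j, hj, hr, -⟩ := exists_chart f m U hU
  refine ⟨WedgeAlg k m (sectionsAlg f U), inferInstance, inferInstance, inferInstance, j,
    j.isOpenEmbedding, ?_⟩
  change x ∈ j.opensRange
  rw [hr]
  exact hxU

/-- The constant wedges give a retraction `r` of `base`, hence a section of the map on spectra. -/
theorem base_comap_surjective (k : Type*) (m : ℕ) (A : Type*) [CommRing k] [CommRing A]
    [Algebra k A] :
    Function.Surjective (PrimeSpectrum.comap (WedgeAlg.base k m A).toRingHom) := by
  let r : WedgeAlg k m A →ₐ[k] A := WedgeAlg.lift (IsScalarTower.toAlgHom k A (Trunc m A))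
  have hr : r.toRingHom.comp (WedgeAlg.base k m A).toRingHom = RingHom.id A := by
    ext a
    change WedgeAlg.lift _ (WedgeAlg.d k m 0 a) = a
    rw [WedgeAlg.lift_d, IsScalarTower.coe_toAlgHom', Trunc.coeff_algebraMap]
    simp
  intro p
  refine ⟨PrimeSpectrum.comap r.toRingHom p, ?_⟩
  rw [← PrimeSpectrum.comap_comp_apply, hr, PrimeSpectrum.comap_id]

/-- The projection from the wedge scheme is surjective. -/
theorem wedgeProj_surjective : Function.Surjective (wedgeProj f m) := by
  intro x
  obtain ⟨_, ⟨U, hU, rfl⟩, hxU, -⟩ :=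
    X.isBasis_affineOpens.exists_subset_of_mem_open (Set.mem_univ x) isOpen_univ
  obtain ⟨j, hj, -, hc⟩ := exists_chart f m U hU
  obtain ⟨y, hy⟩ := hU.range_fromSpec.ge hxU
  obtain ⟨z, hz⟩ := base_comap_surjective k m (sectionsAlg f U)
    (show PrimeSpectrum (sectionsAlg f U) from y)
  refine ⟨j z, (congr($hc z) : _).trans ?_⟩
  exact (congrArg hU.fromSpec hz).trans hy

end Charts

/-! ### Local complete intersections and the smooth locus -/

section LocallyCompleteIntersection

open TopologicalSpace Topology Limits

variable {k : Type u} [Field k] {X : Scheme.{u}} (f : X ⟶ Spec (.of k)) (m : ℕ)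

theorem topologicalKrullDim_opens_eq [IsIntegral X] [LocallyOfFiniteType f] (U : X.Opens)
    (hne : (U : Set X).Nonempty) : topologicalKrullDim U = topologicalKrullDim X := by
  have h := (isLocallySpecOfFiniteType f).topologicalKrullDim_inter
    (IrreducibleSpace.isIrreducible_univ X) isClosed_univ U.2 (by rwa [Set.univ_inter])
  rw [IsHomeomorph.topologicalKrullDim_eq _ (Homeomorph.Set.univ X).isHomeomorph] at h
  rw [← h, Set.univ_inter]
  rfl

/-- A variety of dimension `n` that is locally a complete intersection is locally given by `c`
equations in the affine space of dimension `n + c`. -/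
theorem IsLocallyCompleteIntersection.exists_algEquiv [IsIntegral X] [LocallyOfFiniteType f]
    (hX : IsLocallyCompleteIntersection f) {n : ℕ} (hn : topologicalKrullDim X = n) (x : X) :
    ∃ (U : X.Opens) (N c : ℕ) (g : Fin c → MvPolynomial (Fin N) k), x ∈ U ∧ IsAffineOpen U ∧
      n + c = N ∧
      Nonempty ((MvPolynomial (Fin N) k ⧸ Ideal.span (Set.range g)) ≃ₐ[k] sectionsAlg f U) := by
  obtain ⟨U, N, c, g, hxU, hdim, e, he⟩ := hX x
  obtain ⟨hU, ⟨E⟩⟩ := nonempty_algEquiv_of_iso f U _ e he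
  refine ⟨U, N, c, g, hxU, hU, ?_, ⟨E⟩⟩
  have h1 : ringKrullDim (MvPolynomial (Fin N) k ⧸ Ideal.span (Set.range g)) = n := by
    rw [← hn, ← topologicalKrullDim_opens_eq f U ⟨x, hxU⟩,
      topologicalKrullDim_eq_ringKrullDim_of_isAffineOpen U hU]
    exact ringKrullDim_eq_of_ringEquiv E.toRingEquiv
  rw [h1] at hdim
  exact_mod_cast hdim

/-- With `r = Nat.card (Exponent m)`, the presentation has `(n + c) * r` variables and `c * r`
equations, so Krull's bound leaves `n * r`. -/
theorem le_height_of_isMaximal_wedgeAlg {k : Type*} [Field k] {A : Type*} [CommRing A] [Algebra k A]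
    {n N c : ℕ} (m : ℕ) (g : Fin c → MvPolynomial (Fin N) k) (hN : n + c = N)
    (e : (MvPolynomial (Fin N) k ⧸ Ideal.span (Set.range g)) ≃ₐ[k] A)
    (M : Ideal (WedgeAlg k m A)) [M.IsMaximal] :
    ((n * Nat.card (Exponent m) : ℕ) : ℕ∞) ≤ M.height := by
  let E := ((WedgeAlg.mapEquiv k m e.symm).trans (WedgeAlg.presentation m g)).toRingEquiv
  have hM : (M.map E).IsMaximal := Ideal.map_isMaximal_of_equiv E
  have h := natCard_le_height_add_of_isMaximal_quotient k (WedgeAlg.wedgeEquations m g) (M.map E)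
  rw [E.height_map, Nat.card_prod, Nat.card_prod, Nat.card_fin, Nat.card_fin, ← hN, add_mul,
    Nat.cast_add] at h
  exact (ENat.add_le_add_iff_right (ENat.natCast_ne_top _)).mp h

theorem le_topologicalKrullDim_of_isOpen_wedgeScheme [IsIntegral X] [LocallyOfFiniteType f]
    (hX : IsLocallyCompleteIntersection f) {n : ℕ} (hn : topologicalKrullDim X = n)
    (O : Set (wedgeScheme f m)) (hO : IsOpen O) (hne : O.Nonempty) :
    ((n * Nat.card (Exponent m) : ℕ) : WithBot ℕ∞) ≤ topologicalKrullDim O := by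
  obtain ⟨x, hx⟩ := hne
  obtain ⟨U, N, c, g, hxU, hU, hN, ⟨e⟩⟩ := hX.exists_algEquiv f hn (wedgeProj f m x)
  obtain ⟨j, hj, hr, -⟩ := exists_chart f m U hU
  have := finiteType_sectionsAlg f ⟨U, hU⟩
  have : IsJacobsonRing (WedgeAlg k m (sectionsAlg f U)) := isJacobsonRing_of_finiteType (A := k)
  have hxj : x ∈ j.opensRange := by rw [hr]; exact hxU
  obtain ⟨y, rfl⟩ := hxj
  refine (le_topologicalKrullDim_of_isOpen (A := WedgeAlg k m (sectionsAlg f U))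
    (fun M hM ↦ ?_) (hO.preimage j.continuous) ⟨y, hx⟩).trans
    ((j.isOpenEmbedding.isEmbedding.topologicalKrullDim_preimage_le O).trans
      (topologicalKrullDim_mono Set.inter_subset_left))
  have := le_height_of_isMaximal_wedgeAlg m g hN e M
  exact_mod_cast this

end LocallyCompleteIntersection

/-! ### The smooth locus of the base -/

section Smooth

open TopologicalSpace Topology Limits

variable {k : Type u} [Field k] {X : Scheme.{u}} (f : X ⟶ Spec (.of k)) (m : ℕ)

theorem isOpen_compl_singularLocus : IsOpen (singularLocus f)ᶜ := by
  rw [isOpen_iff_forall_mem_open]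
  intro x hx
  obtain ⟨U, hxU, hU⟩ := not_not.mp hx
  exact ⟨U, fun y hy ↦ not_not.mpr ⟨U, hy, hU⟩, U.2, hxU⟩

/-- A smooth variety is locally étale over an affine space. -/
theorem exists_etale_of_notMem_singularLocus (x : X) (hx : x ∉ singularLocus f) :
    ∃ V : X.Opens, x ∈ V ∧ IsAffineOpen V ∧ (V : Set X) ⊆ (singularLocus f)ᶜ ∧
      ∃ (d : ℕ) (g : MvPolynomial (Fin d) k →ₐ[k] sectionsAlg f V), g.toRingHom.Etale := by
  obtain ⟨U, hxU, hU⟩ := not_not.mp hx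
  obtain ⟨S, hS, V, hV, hxV, hle, hstd⟩ := Smooth.exists_isStandardSmooth (U.ι ≫ f) ⟨x, hxU⟩
  -- `Spec k` is a single point, so its nonempty open subset `S` is everything.
  obtain rfl : S = ⊤ := by
    rw [← top_le_iff]
    intro y _
    have : Subsingleton (Spec (.of k)) := inferInstanceAs (Subsingleton (PrimeSpectrum k))
    rw [Subsingleton.elim y ((U.ι ≫ f) ⟨x, hxU⟩)]
    exact hle hxV
  refine ⟨U.ι ''ᵁ V, ⟨⟨x, hxU⟩, hxV, rfl⟩, hV.image_of_isOpenImmersion U.ι, ?_, ?_⟩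
  · rintro _ ⟨y, -, rfl⟩
    exact not_not.mpr ⟨U, y.2, hU⟩
  · have heq : sectionsMap f (U.ι ''ᵁ V) =
        ((U.ι ≫ f).appLE ⊤ V hle).hom.comp (Scheme.ΓSpecIso (.of k)).inv.hom := by
      have : (U.ι ≫ f).appLE ⊤ V hle = f.appLE ⊤ (U.ι ''ᵁ V) le_top := by
        rw [← Scheme.Hom.appLE_comp_appLE _ _ ⊤ (U.ι ''ᵁ V) V le_top (U.ι.preimage_image_eq V).ge,
          Scheme.Opens.ι_appLE]
        exact (congrArg _ (X.presheaf.map_id _)).trans (Category.comp_id _)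
      rw [this]
      rfl
    have hs : (sectionsMap f (U.ι ''ᵁ V)).IsStandardSmooth := by
      rw [heq]
      exact RingHom.isStandardSmooth_respectsIso.2 _
        (Scheme.ΓSpecIso (.of k)).symm.commRingCatIsoToRingEquiv hstd
    obtain ⟨d, g, hg, het⟩ := hs.exists_etale_mvPolynomial
    exact ⟨d, { g with commutes' := fun c ↦ congr($hg c) }, het⟩

/-- Generic smoothness: over a perfect field the generic point lies in the smooth locus. -/
theorem exists_notMem_singularLocus [PerfectField k] [IsIntegral X] [LocallyOfFiniteType f] :
    ∃ x, x ∉ singularLocus f := by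
  have : LocallyOfFinitePresentation f := inferInstance
  refine ⟨genericPoint X, not_not.mpr ⟨f.smoothLocus, ?_, ?_⟩⟩
  · exact f.genericPoint_mem_smoothLocus_of_perfectField
  · rw [← Scheme.Hom.smoothLocus_eq_top_iff, ← Scheme.Hom.preimage_smoothLocus_eq]
    ext x
    simp
end Smooth

/-! ### The wedge scheme over the smooth locus -/

section Smooth

open TopologicalSpace Topology Limits

/-- A maximal ideal of `B` contracts to a maximal ideal, of height `d`, by the Nullstellensatz for
Jacobson rings; flatness gives going down, so its own height is at least `d`. -/
theorem le_ringKrullDim_of_flat_mvPolynomial (k : Type*) [Field k] (d : ℕ) (B : Type*) [CommRing B]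
    [Nontrivial B] [Algebra (MvPolynomial (Fin d) k) B] [Module.Flat (MvPolynomial (Fin d) k) B]
    [Algebra.FiniteType (MvPolynomial (Fin d) k) B] : (d : WithBot ℕ∞) ≤ ringKrullDim B := by
  have : IsNoetherianRing B := Algebra.FiniteType.isNoetherianRing (MvPolynomial (Fin d) k) B
  obtain ⟨M, hM⟩ := Ideal.exists_maximal B
  have : (M.under (MvPolynomial (Fin d) k)).IsMaximal := by
    let := Ideal.Quotient.field M
    have := finite_of_finite_type_of_isJacobsonRing (MvPolynomial (Fin d) k) (B ⧸ M)
    have h := Ideal.isMaximal_comap_of_isIntegral_of_isMaximal (R := MvPolynomial (Fin d) k)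
      (⊥ : Ideal (B ⧸ M))
    rwa [IsScalarTower.algebraMap_eq (MvPolynomial (Fin d) k) B (B ⧸ M), ← Ideal.comap_comap,
      Ideal.Quotient.algebraMap_eq, ← RingHom.ker_eq_comap_bot, Ideal.mk_ker] at h
  have h := Ideal.height_eq_height_add_of_liesOver_of_hasGoingDown
    (M.under (MvPolynomial (Fin d) k)) M
  rw [height_eq_of_isMaximal_mvPolynomial_fin] at h
  refine le_trans ?_ (Ideal.height_le_ringKrullDim_of_ne_top (I := M) Ideal.IsPrime.ne_top')
  rw [h]
  exact_mod_cast (le_self_add : (d : ℕ∞) ≤ d + _)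

variable {k : Type u} [Field k] {X : Scheme.{u}} (f : X ⟶ Spec (.of k)) (m : ℕ)

theorem topologicalKrullDim_preimage_wedgeProj (U : X.Opens) (hU : IsAffineOpen U) :
    topologicalKrullDim (wedgeProj f m ⁻¹' U) = ringKrullDim (WedgeAlg k m (sectionsAlg f U)) := by
  obtain ⟨j, hj, hr, -⟩ := exists_chart f m U hU
  have hr' : wedgeProj f m ⁻¹' U = Set.range j := congrArg SetLike.coe hr.symm
  rw [hr', ← PrimeSpectrum.topologicalKrullDim_eq_ringKrullDim]
  exact (IsHomeomorph.topologicalKrullDim_eq _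
    j.isOpenEmbedding.isEmbedding.toHomeomorph.isHomeomorph).symm

theorem isIrreducible_preimage_wedgeProj (U : X.Opens) (hU : IsAffineOpen U)
    [IsDomain (WedgeAlg k m (sectionsAlg f U))] : IsIrreducible (wedgeProj f m ⁻¹' U) := by
  obtain ⟨j, hj, hr, -⟩ := exists_chart f m U hU
  have hr' : wedgeProj f m ⁻¹' U = Set.range j := congrArg SetLike.coe hr.symm
  rw [hr', ← Set.image_univ]
  have : IrreducibleSpace (Spec (.of (WedgeAlg k m (sectionsAlg f U)))) :=
    inferInstanceAs (IrreducibleSpace (PrimeSpectrum (WedgeAlg k m (sectionsAlg f U))))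
  exact (IrreducibleSpace.isIrreducible_univ _).image j j.continuous.continuousOn

theorem natCard_nonzero_exponent (m : ℕ) :
    Nat.card {e : Exponent m // e.1 ≠ 0} + 1 = Nat.card (Exponent m) := by
  classical
  have := Fintype.ofFinite (Exponent m)
  rw [Nat.card_eq_fintype_card, Nat.card_eq_fintype_card]
  have h := Fintype.card_subtype_compl (fun e : Exponent m ↦ e = ⟨0, by simp⟩)
  rw [Fintype.card_subtype_eq] at h
  have hpos : 0 < Fintype.card (Exponent m) := Fintype.card_pos_iff.mpr ⟨⟨0, by simp⟩⟩
  have h2 : Fintype.card {e : Exponent m // e.1 ≠ 0} =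
      Fintype.card {e : Exponent m // ¬ e = ⟨0, by simp⟩} :=
    Fintype.card_congr (Equiv.subtypeEquivRight fun e ↦ by simp [Subtype.ext_iff])
  omega

/-- On an étale chart over affine `d`-space, the wedge algebra is a polynomial ring in `d * (r - 1)`
variables over a domain of dimension `n`, where `r = Nat.card (Exponent m)`. Hence it is a domain of
dimension `n + d * (r - 1)`. Flatness gives `d ≤ n`, so this is at most `n * r`; counting equations
gives the opposite inequality, so `d = n` need not be proved separately. -/
theorem exists_smooth_chart [IsIntegral X] [LocallyOfFiniteType f]
    (hX : IsLocallyCompleteIntersection f) {n : ℕ} (hn : topologicalKrullDim X = n)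
    (x : X) (hx : x ∉ singularLocus f) :
    ∃ V : X.Opens, x ∈ V ∧ (V : Set X) ⊆ (singularLocus f)ᶜ ∧
      IsIrreducible (wedgeProj f m ⁻¹' V) ∧
      topologicalKrullDim (wedgeProj f m ⁻¹' V) = (n * Nat.card (Exponent m) : ℕ) := by
  obtain ⟨V, hxV, hV, hsub, d, g, hg⟩ := exists_etale_of_notMem_singularLocus f x hx
  let _ : Algebra (MvPolynomial (Fin d) k) (sectionsAlg f V) := g.toRingHom.toAlgebra
  have : IsScalarTower k (MvPolynomial (Fin d) k) (sectionsAlg f V) :=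
    .of_algebraMap_eq' g.comp_algebraMap.symm
  have : Algebra.Etale (MvPolynomial (Fin d) k) (sectionsAlg f V) := hg
  have : Nonempty V := ⟨⟨x, hxV⟩⟩
  have : IsDomain (sectionsAlg f V) := inferInstanceAs (IsDomain Γ(X, V))
  have := finiteType_sectionsAlg f ⟨V, hV⟩
  have : IsNoetherianRing (sectionsAlg f V) := Algebra.FiniteType.isNoetherianRing k _
  obtain ⟨e⟩ := WedgeAlg.nonempty_equiv_of_formallyEtale k m (Fin d) (sectionsAlg f V)
  have hdom : IsDomain (WedgeAlg k m (sectionsAlg f V)) := e.toMulEquiv.isDomain _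
  refine ⟨V, hxV, hsub, isIrreducible_preimage_wedgeProj f m V hV, ?_⟩
  have hdim : ringKrullDim (sectionsAlg f V) = n := by
    rw [← hn, ← topologicalKrullDim_opens_eq f V ⟨x, hxV⟩]
    exact (topologicalKrullDim_eq_ringKrullDim_of_isAffineOpen V hV).symm
  have hle := le_ringKrullDim_of_flat_mvPolynomial k d (sectionsAlg f V)
  rw [hdim] at hle
  have hd : d ≤ n := by exact_mod_cast hle
  have hW : topologicalKrullDim (wedgeProj f m ⁻¹' V) =
      (n + d * Nat.card {e : Exponent m // e.1 ≠ 0} : ℕ) := by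
    rw [topologicalKrullDim_preimage_wedgeProj f m V hV, ringKrullDim_eq_of_ringEquiv e.toRingEquiv,
      MvPolynomial.ringKrullDim_of_isNoetherianRing, hdim, Nat.card_prod, Nat.card_fin]
    norm_cast
  have hge := le_topologicalKrullDim_of_isOpen_wedgeScheme f m hX hn (wedgeProj f m ⁻¹' V)
    (V.2.preimage (wedgeProj f m).continuous) (by
      obtain ⟨y, hy⟩ := wedgeProj_surjective f m x
      exact ⟨y, by rw [Set.mem_preimage, hy]; exact hxV⟩)
  rw [hW] at hge ⊢
  rw [← natCard_nonzero_exponent] at hge ⊢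
  refine le_antisymm ?_ hge
  have : d * Nat.card {e : Exponent m // e.1 ≠ 0} ≤ n * Nat.card {e : Exponent m // e.1 ≠ 0} :=
    Nat.mul_le_mul_right _ hd
  have h2 : n + d * Nat.card {e : Exponent m // e.1 ≠ 0} ≤
    n * (Nat.card {e : Exponent m // e.1 ≠ 0} + 1) := by rw [mul_add, mul_one]; omega
  exact_mod_cast h2

/-- The preimage is covered by irreducible open sets, any two of which meet: their images are
nonempty open subsets of the irreducible `X`, and the projection is surjective. -/
theorem isIrreducible_preimage_compl_singularLocus [PerfectField k] [IsIntegral X]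
    [LocallyOfFiniteType f] (hX : IsLocallyCompleteIntersection f) {n : ℕ}
    (hn : topologicalKrullDim X = n) : IsIrreducible (wedgeProj f m ⁻¹' (singularLocus f)ᶜ) := by
  refine ⟨?_, ?_⟩
  · obtain ⟨x, hx⟩ := exists_notMem_singularLocus f
    obtain ⟨y, rfl⟩ := wedgeProj_surjective f m x
    exact ⟨y, hx⟩
  · rintro u v hu hv ⟨y, hy, hyu⟩ ⟨z, hz, hzv⟩
    obtain ⟨V, hyV, hV, hVi, -⟩ := exists_smooth_chart f m hX hn _ hy
    obtain ⟨V', hzV', hV', hVi', -⟩ := exists_smooth_chart f m hX hn _ hz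
    have ho : IsOpen (wedgeProj f m ⁻¹' V) := V.2.preimage (wedgeProj f m).continuous
    have ho' : IsOpen (wedgeProj f m ⁻¹' V') := V'.2.preimage (wedgeProj f m).continuous
    obtain ⟨x, hxV, hxV'⟩ : ((V : Set X) ∩ V').Nonempty :=
      nonempty_preirreducible_inter V.2 V'.2 ⟨_, hyV⟩ ⟨_, hzV'⟩
    obtain ⟨w, rfl⟩ := wedgeProj_surjective f m x
    -- Irreducibility over `V` moves a point of `u` into the overlap with `V'`; irreducibility over
    -- `V'` then makes `u` and `v` meet.
    obtain ⟨a, haV, haV', hau⟩ := hVi.isPreirreducible _ u ho' hu ⟨w, hxV, hxV'⟩ ⟨y, hyV, hyu⟩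
    obtain ⟨b, hbV', hbu, hbv⟩ := hVi'.isPreirreducible u v hu hv ⟨a, haV', hau⟩ ⟨z, hzV', hzv⟩
    exact ⟨b, hV' hbV', hbu, hbv⟩

end Smooth

/-! ### Complete intersection charts of the wedge scheme -/

section LocallyCompleteIntersection

open TopologicalSpace Topology Limits

theorem exists_algEquiv_fin {k : Type*} [CommRing k] {σ ι : Type*} {N c : ℕ} (eσ : σ ≃ Fin N)
    (eι : ι ≃ Fin c) (g : ι → MvPolynomial σ k) :
    ∃ g' : Fin c → MvPolynomial (Fin N) k, Nonempty
      ((MvPolynomial σ k ⧸ Ideal.span (Set.range g)) ≃ₐ[k]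
        MvPolynomial (Fin N) k ⧸ Ideal.span (Set.range g')) := by
  refine ⟨MvPolynomial.renameEquiv k eσ ∘ g ∘ eι.symm,
    ⟨Ideal.quotientEquivAlg _ _ (MvPolynomial.renameEquiv k eσ) ?_⟩⟩
  rw [Ideal.map_span, Set.range_comp, eι.symm.surjective.range_comp]
  rfl

variable {k : Type u} [Field k] {X : Scheme.{u}} (f : X ⟶ Spec (.of k)) (m : ℕ)

/-- The hypothesis `hW` bounds the dimension of each chart above and the equation count bounds it
below, so the chart has dimension equal to variables minus equations. -/
theorem isLocallyCompleteIntersection_wedgeScheme [IsIntegral X] [LocallyOfFiniteType f]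
    (hX : IsLocallyCompleteIntersection f) {n : ℕ} (hn : topologicalKrullDim X = n)
    (hW : topologicalKrullDim (wedgeScheme f m) = (n * Nat.card (Exponent m) : ℕ)) :
    IsLocallyCompleteIntersection (wedgeProj f m ≫ f) := by
  intro x
  obtain ⟨U, N, c, g, hxU, hU, hN, ⟨e⟩⟩ := hX.exists_algEquiv f hn (wedgeProj f m x)
  obtain ⟨j, hj, hr, hc⟩ := exists_chart f m U hU
  obtain ⟨g', ⟨e'⟩⟩ := exists_algEquiv_fin
    (Finite.equivFinOfCardEq (n := N * Nat.card (Exponent m)) (by simp))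
    (Finite.equivFinOfCardEq (n := c * Nat.card (Exponent m)) (by simp))
    (WedgeAlg.wedgeEquations m g)
  let E := (WedgeAlg.mapEquiv k m e.symm).trans ((WedgeAlg.presentation m g).trans e')
  refine ⟨j.opensRange, _, _, g', by rw [hr]; exact hxU, ?_, ?_⟩
  · have h1 : ringKrullDim (WedgeAlg k m (sectionsAlg f U)) = (n * Nat.card (Exponent m) : ℕ) := by
      rw [← topologicalKrullDim_preimage_wedgeProj f m U hU]
      refine le_antisymm ((topologicalKrullDim_subspace_le _ _).trans hW.le) ?_
      exact le_topologicalKrullDim_of_isOpen_wedgeScheme f m hX hn _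
        (U.2.preimage (wedgeProj f m).continuous) ⟨x, hxU⟩
    rw [← ringKrullDim_eq_of_ringEquiv E.toRingEquiv, h1, ← hN]
    norm_cast
    ring
  · refine ⟨j.isoOpensRange.symm ≪≫
      Scheme.Spec.mapIso (E.symm.toRingEquiv.toCommRingCatIso).op, ?_⟩
    -- Both composites are the structure map of the wedge algebra over `k`; this makes the chart
    -- isomorphism one over `k`.
    have h1 : (CommRingCat.ofHom (algebraMap k (MvPolynomial (Fin (N * Nat.card (Exponent m))) k ⧸
        Ideal.span (Set.range g')))) ≫ CommRingCat.ofHom E.symm.toRingEquiv.toRingHom =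
        CommRingCat.ofHom (sectionsMap f U) ≫
          CommRingCat.ofHom (WedgeAlg.base k m (sectionsAlg f U)).toRingHom := by
      ext c
      exact (E.symm.commutes c).trans ((WedgeAlg.base k m (sectionsAlg f U)).commutes c).symm
    have h2 : Spec.map (CommRingCat.ofHom E.symm.toRingEquiv.toRingHom) ≫
        Spec.map (CommRingCat.ofHom (algebraMap k (MvPolynomial (Fin (N * Nat.card (Exponent m))) k ⧸
        Ideal.span (Set.range g')))) = j ≫ wedgeProj f m ≫ f := by
      rw [← Spec.map_comp, h1, Spec.map_comp, ← fromSpec_comp f U hU, reassoc_of% hc]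
      exact (Category.assoc _ _ _).symm
    rw [← j.isoOpensRange_inv_comp, Category.assoc, ← h2]
    exact Category.assoc _ _ _

end LocallyCompleteIntersection

end WedgeScheme

open WedgeScheme in
theorem mainTheorem3 {k : Type u} [Field k] [IsAlgClosed k] [CharZero k]
    {X : Scheme.{u}} (f : X ⟶ Spec (.of k))
    [IsIntegral X] [IsSeparated f] [LocallyOfFiniteType f] [QuasiCompact f]
    (n : ℕ) (hn : topologicalKrullDim X = n)
    (hX : IsLocallyCompleteIntersection f) (m : ℕ) :
    (IsPureDimensional (wedgeScheme f m) ↔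
      topologicalKrullDim (wedgeScheme f m) = (n * (m + 1) * (m + 2) / 2 : ℕ)) ∧
    (IsPureDimensional (wedgeScheme f m) →
      IsLocallyCompleteIntersection (wedgeProj f m ≫ f)) ∧
    (IrreducibleSpace (wedgeScheme f m) ↔
      topologicalKrullDim (wedgeProj f m ⁻¹' singularLocus f) <
        (n * (m + 1) * (m + 2) / 2 : ℕ)) := by
  -- The natural-number division is exact because `(m+1)(m+2)` is even.
  have hD : n * (m + 1) * (m + 2) / 2 = n * Nat.card (Exponent m) := by
    rw [natCard_exponent, mul_assoc]
    exact Nat.mul_div_assoc n (Nat.even_mul_succ_self (m + 1)).two_dvd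
  rw [hD]
  obtain ⟨x, hx⟩ := exists_notMem_singularLocus f
  obtain ⟨V, hxV, hV, hVi, hVD⟩ := exists_smooth_chart f m hX hn x hx
  -- The topological criterion is applied with `R` the preimage of the smooth locus and with the
  -- preimage of a single smooth chart witnessing the dimension.
  obtain ⟨h1, h2⟩ :=
    (isLocallySpecOfFiniteType_wedgeScheme f m).pureDimensional_iff_and_irreducible_iff
      (le_topologicalKrullDim_of_isOpen_wedgeScheme f m hX hn)
      ((isOpen_compl_singularLocus f).preimage (wedgeProj f m).continuous)
      (isIrreducible_preimage_compl_singularLocus f m hX hn)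
      (V.2.preimage (wedgeProj f m).continuous) (Set.preimage_mono hV) hVi.nonempty hVD
  refine ⟨h1, fun h ↦ isLocallyCompleteIntersection_wedgeScheme f m hX hn (h1.mp h), ?_⟩
  rw [h2, Set.preimage_compl, compl_compl]
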